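/- Let $\theta,\Theta_1,\Theta_2:[0,+\infty)\to[0,+\infty)$ be functions, with $\Theta_1,\Theta_2$ convex and lower semicontinuous, such that $$\lim_{x\to\infty}\theta(x)=\lim_{x\to\infty}\frac{\Theta_1(x)}{x}=\lim_{x\to\infty}\frac{\Theta_2(x)}{x}=+\infty,$$ and such that, for some constant $C\ge 0$, $\Theta_2(2x)\le C\,\Theta_2(x)$ for all $x\ge 0$. Then there exists a functional $\Psi:C([0,1];\mathbb{R})\to[0,+\infty]$ (depending only on $\theta,\Theta_1,\Theta_2$) which is coercive, i.e. $\{\Psi\le c\}$ is compact for the uniform topology for every $c\in[0,+\infty)$, with the following property. Let $(\Omega,(\mathcal{F}_t)_{t\in[0,1]},\mathbb{P})$ be any filtered probability space (no completeness or right-continuity of the filtration is required) and let $\varphi,\beta,\alpha$ be real-valued progressively measurable processes indexed by $[0,1]$ with $\int_0^1(|\beta_t|+|\alpha_t|)\,dt<\infty$ and $\alpha\ge 0$ $\mathbb{P}$-a.s., such that, setting $M_t:=\varphi_t-\int_0^t\beta_s\,ds$, the processes $$M_t\quad\text{and}\quad M_t^2-\int_0^t\alpha_s\,ds,\qquad t\in[0,1],$$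 are $\mathbb{P}$-a.s. continuous local martingales. Then $$\mathbb{E}[\Psi(\varphi)]\le\mathbb{E}\Big[\theta(|\varphi_0|)+\int_0^1\big(\Theta_1(|\beta_t|)+\Theta_2(\alpha_t)\big)\,dt\Big].$$ -/

import Mathlib

open MeasureTheory ProbabilityTheory Filter Topology
open scoped NNReal ENNReal unitInterval

/-- A functional with values in `[0, +∞]` is coercive if all its sublevel sets at finite levels
are compact. -/
def IsCoerciveFunctional {X : Type*} [TopologicalSpace X] (F : X → ℝ≥0∞) : Prop :=
  ∀ c : ℝ≥0, IsCompact {x | F x ≤ c}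

/-- The pathwise integral process `t ↦ ∫₀ᵗ β_s ds`, for a process indexed by `[0, 1]`; the measure
on `[0, 1]` is Lebesgue measure. -/
noncomputable def timeIntegral {Ω : Type*} (β : I → Ω → ℝ) (t : I) (ω : Ω) : ℝ :=
  ∫ s in Set.Iic t, β s ω

/-- A `P`-a.s. continuous local martingale on `[0, 1]`. In `WithTop I` the top element is
isolated, so the localizing stopping times are almost surely eventually equal to `⊤`, i.e. the
localization reaches the closed interval `[0, 1]`. -/
structure IsContinuousLocalMartingale {Ω : Type*} {mΩ : MeasurableSpace Ω}
    (P : Measure Ω) (𝓕 : Filtration I mΩ) (X : I → Ω → ℝ) : Prop where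
  continuous_paths : ∀ᵐ ω ∂P, Continuous fun t => X t ω
  locally_martingale : Locally (fun Y : I → Ω → ℝ => Martingale Y 𝓕 P) 𝓕 X P

open Classical in
/-- The value of a functional on `C([0, 1]; ℝ)` at a path, set to `+∞` if the path is
not continuous (for the processes below this happens only on a null set). -/
noncomputable def pathValue (Ψ : C(I, ℝ) → ℝ≥0∞) (f : I → ℝ) : ℝ≥0∞ :=
  if h : Continuous f then Ψ ⟨f, h⟩ else ⊤

/-! The functional is a supremum over `i` of penalties `i` on `|f 0| > r i`, plus a sum over `j` of
penalties `j` on oscillating by more than `1 / (j + 1)` on some cell of a grid of mesh `1 / n j`. A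
sublevel set bounds the initial value and controls the modulus of continuity at all fine scales, so
Arzelà–Ascoli gives coercivity whatever `r` and `n` are. The supremum is at most `θ(|f 0|)` once `θ
≥ i` beyond `r i`. It remains to choose `n j`, from `Θ₁` and `Θ₂` alone, so that the probability of
the `j`-th oscillation is at most `δ j / (j + 1)` times the expected cost, with `∑ δ j < 1`; this is
`exists_measure_iUnion_exceedEvent_le`.

The cost is additive over cells, so it suffices to bound each cell by a small multiple of its own
cost, with no additive error. Split the increment into drift and martingale. On a short cell a large
drift forces a huge `∫ Θ₁(|β|)` by superlinearity, and Markov's inequality applies. For the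
martingale, Chebyshev with the bracket is too weak, since `Θ₂` may be much smaller than `x` near
`0`. Doubling, however, bounds some power `x ^ p` by a multiple of `Θ₂` on bounded sets
(`exists_pow_le_mul`), so a truncated `p`-th moment of the bracket increment is affordable
(`exists_min_one_pow_lintegral_le`). That moment controls the exceedance probability
(`exists_measure_exceedEvent_le`) by iterating a good-λ inequality over dyadic levels.

The good-λ inequality needs optional sampling at entrance times. Without the usual conditions on the
filtration these are only optional times, so they are approximated from above by stopping times with
countable range. -/

/-! ### Optional sampling in continuous time -/

/-- The least point of the form `k / (m + 1)` strictly above `x`, capped at `1`. -/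
noncomputable def roundUp (m : ℕ) (x : I) : I :=
  Set.projIcc 0 1 zero_le_one (((⌊((m : ℝ) + 1) * x⌋ : ℝ) + 1) / ((m : ℝ) + 1))

lemma coe_roundUp (m : ℕ) (x : I) :
    (roundUp m x : ℝ) = min 1 (((⌊((m : ℝ) + 1) * x⌋ : ℝ) + 1) / ((m : ℝ) + 1)) := by
  have hm : (0 : ℝ) < (m : ℝ) + 1 := by positivity
  have h0 : (0 : ℝ) ≤ ⌊((m : ℝ) + 1) * x⌋ := by
    exact_mod_cast Int.floor_nonneg.2 (mul_nonneg hm.le x.2.1)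
  rw [roundUp, Set.coe_projIcc, max_eq_right]
  exact le_min zero_le_one (by positivity)

lemma roundUp_mono (m : ℕ) : Monotone (roundUp m) := by
  intro x y hxy
  have hm : (0 : ℝ) < (m : ℝ) + 1 := by positivity
  have hxy' : (x : ℝ) ≤ y := hxy
  refine Set.monotone_projIcc _ ?_
  have : ⌊((m : ℝ) + 1) * x⌋ ≤ ⌊((m : ℝ) + 1) * y⌋ := by gcongr
  have : (⌊((m : ℝ) + 1) * x⌋ : ℝ) ≤ ⌊((m : ℝ) + 1) * y⌋ := by exact_mod_cast this
  gcongr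

lemma tendsto_roundUp (x : I) : Tendsto (fun m => roundUp m x) atTop (𝓝 x) := by
  rw [tendsto_subtype_rng]
  have h1 : Tendsto (fun m : ℕ => (x : ℝ) + 1 / ((m : ℝ) + 1)) atTop (𝓝 (x : ℝ)) := by
    simpa using tendsto_const_nhds.add (tendsto_one_div_add_atTop_nhds_zero_nat (𝕜 := ℝ))
  refine tendsto_of_tendsto_of_tendsto_of_le_of_le tendsto_const_nhds h1 (fun m => ?_) fun m => ?_
  · have hm : (0 : ℝ) < (m : ℝ) + 1 := by positivity
    change (x : ℝ) ≤ roundUp m x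
    rw [coe_roundUp]
    refine le_min x.2.2 ?_
    rw [le_div_iff₀ hm, mul_comm]
    exact (Int.lt_floor_add_one _).le
  · have hm : (0 : ℝ) < (m : ℝ) + 1 := by positivity
    change (roundUp m x : ℝ) ≤ _
    rw [coe_roundUp]
    refine (min_le_right _ _).trans ?_
    rw [div_le_iff₀ hm, mul_comm ((m : ℝ) + 1) (x : ℝ), add_mul (x : ℝ) (1 / ((m : ℝ) + 1)),
      one_div_mul_cancel hm.ne']
    gcongr
    exact Int.floor_le _

lemma countable_range_roundUp (m : ℕ) : (Set.range (roundUp m)).Countable := by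
  refine (Set.countable_range fun k : ℤ =>
    Set.projIcc (0 : ℝ) 1 zero_le_one (((k : ℝ) + 1) / ((m : ℝ) + 1))).mono ?_
  rintro _ ⟨x, rfl⟩
  exact ⟨_, rfl⟩

/-- Because rounding goes strictly upwards, the condition on the right is a strict inequality; this
is what turns an optional time into a genuine stopping time. The cap breaks the equivalence at `v =
1`, where the event is everything anyway. -/
lemma exists_roundUp_le_iff (m : ℕ) {v : I} (hv : v < 1) :
    ∃ q ≤ v, ∀ x, roundUp m x ≤ v ↔ x < q := by
  have hm : (0 : ℝ) < (m : ℝ) + 1 := by positivity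
  have hv' : (v : ℝ) < 1 := hv
  have h0 : (0 : ℝ) ≤ ⌊((m : ℝ) + 1) * v⌋ := by
    exact_mod_cast Int.floor_nonneg.2 (mul_nonneg hm.le v.2.1)
  have hq : (⌊((m : ℝ) + 1) * v⌋ : ℝ) / ((m : ℝ) + 1) ≤ v := by
    rw [div_le_iff₀ hm, mul_comm (v : ℝ)]
    exact Int.floor_le _
  refine ⟨⟨(⌊((m : ℝ) + 1) * v⌋ : ℝ) / ((m : ℝ) + 1), by positivity, hq.trans v.2.2⟩, hq,
    fun x => ?_⟩
  rw [← Subtype.coe_le_coe, ← Subtype.coe_lt_coe, coe_roundUp, min_le_iff, or_iff_right hv'.not_ge,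
    div_le_iff₀ hm, lt_div_iff₀ hm, mul_comm (v : ℝ), mul_comm (x : ℝ)]
  rw [← Int.floor_lt, ← Int.add_one_le_iff, Int.le_floor]
  push_cast
  rfl

section OptionalSampling

variable {Ω : Type*} {mΩ : MeasurableSpace Ω} {P : Measure Ω} {𝓕 : Filtration I mΩ}
  {X : I → Ω → ℝ} {ρ κ : Ω → I}

/-- An optional time: `{ρ < t}` belongs to the filtration at time `t`. -/
def IsOptionalTime (𝓕 : Filtration I mΩ) (ρ : Ω → I) : Prop :=
  ∀ v, MeasurableSet[𝓕 v] {ω | ρ ω < v}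

lemma IsOptionalTime.isStoppingTime_roundUp (hρ : IsOptionalTime 𝓕 ρ) (m : ℕ) :
    IsStoppingTime 𝓕 fun ω => (roundUp m (ρ ω) : WithTop I) := by
  intro v
  simp only [WithTop.coe_le_coe]
  rcases eq_or_lt_of_le (unitInterval.le_one' (t := v)) with rfl | hv
  · simp [unitInterval.le_one']
  · obtain ⟨q, hqv, hq⟩ := exists_roundUp_le_iff m hv
    simp only [hq]
    exact 𝓕.mono hqv _ (hρ q)

lemma ae_tendsto_roundUp (hc : ∀ᵐ ω ∂P, Continuous fun t => X t ω) (ρ : Ω → I) :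
    ∀ᵐ ω ∂P, Tendsto (fun m => X (roundUp m (ρ ω)) ω) atTop (𝓝 (X (ρ ω) ω)) := by
  filter_upwards [hc] with ω hω
  exact (hω.tendsto (ρ ω)).comp (tendsto_roundUp (ρ ω))

variable [IsProbabilityMeasure P]

lemma MeasureTheory.Martingale.roundUp_ae_eq_condExp (hX : Martingale X 𝓕 P)
    (hρ : IsOptionalTime 𝓕 ρ) (m : ℕ) :
    (fun ω => X (roundUp m (ρ ω)) ω) =ᵐ[P]
      P[X 1 | (hρ.isStoppingTime_roundUp m).measurableSpace] := by
  refine hX.stoppedValue_ae_eq_condExp_of_le_const_of_countable_range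
    (hρ.isStoppingTime_roundUp m) (n := 1) (fun ω => WithTop.coe_le_coe.2 unitInterval.le_one') ?_
  refine ((countable_range_roundUp m).image ((↑) : I → WithTop I)).mono ?_
  rintro _ ⟨ω, rfl⟩
  exact ⟨_, ⟨ρ ω, rfl⟩, rfl⟩

lemma MeasureTheory.Martingale.uniformIntegrable_roundUp (hX : Martingale X 𝓕 P)
    (hρ : IsOptionalTime 𝓕 ρ) :
    UniformIntegrable (fun m ω => X (roundUp m (ρ ω)) ω) 1 P :=
  ((hX.integrable 1).uniformIntegrable_condExp fun m =>
    (hρ.isStoppingTime_roundUp m).measurableSpace_le).ae_eq fun m =>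
      (hX.roundUp_ae_eq_condExp hρ m).symm

lemma MeasureTheory.Martingale.integrable_optionalTime (hX : Martingale X 𝓕 P)
    (hc : ∀ᵐ ω ∂P, Continuous fun t => X t ω) (hρ : IsOptionalTime 𝓕 ρ) :
    Integrable (fun ω => X (ρ ω) ω) P :=
  memLp_one_iff_integrable.1 <| (hX.uniformIntegrable_roundUp hρ).memLp_of_ae_tendsto
    (ae_tendsto_roundUp hc ρ)

lemma integral_mul_condExp_of_bound {m : MeasurableSpace Ω} (hm : m ≤ mΩ) {Z f : Ω → ℝ}
    (hZ : StronglyMeasurable[m] Z) (hf : Integrable f P) {c : ℝ} (hc : ∀ ω, ‖Z ω‖ ≤ c) :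
    ∫ ω, Z ω * P[f | m] ω ∂P = ∫ ω, Z ω * f ω ∂P := by
  have h := condExp_stronglyMeasurable_mul_of_bound hm hZ hf c (ae_of_all _ hc)
  rw [← integral_condExp (μ := P) hm (f := fun ω => Z ω * f ω)]
  exact (integral_congr_ae h).symm

/-- Both sampled values are conditional expectations of `X 1`, and the weight is measurable for the
smaller σ-algebra, so both products have the same integral as the weight times `X 1`. -/
lemma MeasureTheory.Martingale.integral_roundUp_mul_sub_eq_zero (hX : Martingale X 𝓕 P)
    (hκ : IsOptionalTime 𝓕 κ) (hρ : IsOptionalTime 𝓕 ρ) (hle : κ ≤ ρ)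
    {g : ℝ → ℝ} (hg : Continuous g) {c : ℝ} (hgc : ∀ x, ‖g x‖ ≤ c) (m : ℕ) :
    ∫ ω, g (X (roundUp m (κ ω)) ω) * (X (roundUp m (ρ ω)) ω - X (roundUp m (κ ω)) ω) ∂P = 0 := by
  have hκm := hX.roundUp_ae_eq_condExp hκ m
  have hρm := hX.roundUp_ae_eq_condExp hρ m
  -- Using the conditional expectation in place of the sampled value makes measurability at the
  -- stopping time automatic.
  set Z : Ω → ℝ := fun ω => g (P[X 1 | (hκ.isStoppingTime_roundUp m).measurableSpace] ω) with hZ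
  have hZκ : StronglyMeasurable[(hκ.isStoppingTime_roundUp m).measurableSpace] Z :=
    hg.comp_stronglyMeasurable stronglyMeasurable_condExp
  have hZρ : StronglyMeasurable[(hρ.isStoppingTime_roundUp m).measurableSpace] Z :=
    hZκ.mono <| IsStoppingTime.measurableSpace_mono _ _ fun ω =>
      WithTop.coe_le_coe.2 (roundUp_mono m (hle ω))
  have hi : ∀ {m' : MeasurableSpace Ω}, Integrable (fun ω => Z ω * P[X 1 | m'] ω) P :=
    integrable_condExp.bdd_mul (c := c)
      (hZκ.mono (IsStoppingTime.measurableSpace_le _)).aestronglyMeasurable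
      (ae_of_all _ fun ω => hgc _)
  calc _ = ∫ ω, (Z ω * P[X 1 | (hρ.isStoppingTime_roundUp m).measurableSpace] ω
          - Z ω * P[X 1 | (hκ.isStoppingTime_roundUp m).measurableSpace] ω) ∂P := by
        refine integral_congr_ae ?_
        filter_upwards [hκm, hρm] with ω h1 h2
        simp only [hZ]
        rw [h1, h2]
        ring
    _ = 0 := by
        rw [integral_sub hi hi,
          integral_mul_condExp_of_bound (IsStoppingTime.measurableSpace_le _) hZρ
            (hX.integrable 1) fun ω => hgc _,
          integral_mul_condExp_of_bound (IsStoppingTime.measurableSpace_le _) hZκ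
            (hX.integrable 1) fun ω => hgc _, sub_self]

/-- Optional sampling for a martingale with almost surely continuous paths and two optional
times: the increment between them is orthogonal to bounded functions of the earlier value. -/
theorem MeasureTheory.Martingale.integral_optionalTime_mul_sub_eq_zero (hX : Martingale X 𝓕 P)
    (hc : ∀ᵐ ω ∂P, Continuous fun t => X t ω)
    (hκ : IsOptionalTime 𝓕 κ) (hρ : IsOptionalTime 𝓕 ρ) (hle : κ ≤ ρ)
    {g : ℝ → ℝ} (hg : Continuous g) {c : ℝ} (hgc : ∀ x, ‖g x‖ ≤ c) :
    Integrable (fun ω => g (X (κ ω) ω) * (X (ρ ω) ω - X (κ ω) ω)) P ∧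
      ∫ ω, g (X (κ ω) ω) * (X (ρ ω) ω - X (κ ω) ω) ∂P = 0 := by
  have hiκ := hX.integrable_optionalTime hc hκ
  have hiρ := hX.integrable_optionalTime hc hρ
  have hint : Integrable (fun ω => g (X (κ ω) ω) * (X (ρ ω) ω - X (κ ω) ω)) P :=
    (hiρ.sub hiκ).bdd_mul (c := c) (hg.comp_aestronglyMeasurable hiκ.1) (ae_of_all _ fun ω => hgc _)
  refine ⟨hint, ?_⟩
  have hUκ := hX.uniformIntegrable_roundUp hκ
  have hUρ := hX.uniformIntegrable_roundUp hρ
  have hsub : UnifIntegrable ((fun m ω => X (roundUp m (ρ ω)) ω) -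
      fun m ω => X (roundUp m (κ ω)) ω) 1 P :=
    hUρ.unifIntegrable.sub hUκ.unifIntegrable le_rfl hUρ.1 hUκ.1
  have hgm : ∀ m, AEStronglyMeasurable (fun ω => g (X (roundUp m (κ ω)) ω)) P := fun m =>
    hg.comp_aestronglyMeasurable (hUκ.1 m)
  have hc0 : 0 ≤ c := (norm_nonneg _).trans (hgc 0)
  have hprod : UnifIntegrable (fun m ω => g (X (roundUp m (κ ω)) ω) *
      (X (roundUp m (ρ ω)) ω - X (roundUp m (κ ω)) ω)) 1 P := by
    intro ε hε
    -- A bounded factor preserves uniform integrability; `c + 1` replaces `c` to allow division when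
    -- `c = 0`.
    obtain ⟨δ, hδ, h⟩ := hsub (show 0 < ε / (c + 1) by positivity)
    refine ⟨δ, hδ, fun m s hs hsδ => ?_⟩
    have h1 : eLpNorm (s.indicator fun ω => g (X (roundUp m (κ ω)) ω) *
        (X (roundUp m (ρ ω)) ω - X (roundUp m (κ ω)) ω)) 1 P ≤
        ENNReal.ofReal (c + 1) * eLpNorm (s.indicator (((fun m ω => X (roundUp m (ρ ω)) ω) -
          fun m ω => X (roundUp m (κ ω)) ω) m)) 1 P := by
      refine eLpNorm_le_mul_eLpNorm_of_ae_le_mul (ae_of_all _ fun ω => ?_) 1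
      by_cases hω : ω ∈ s
      · simp only [Set.indicator_of_mem hω, norm_mul]
        exact mul_le_mul_of_nonneg_right ((hgc _).trans (by linarith)) (norm_nonneg _)
      · simp [Set.indicator_of_notMem hω]
    refine h1.trans ((mul_le_mul_right (h m s hs hsδ) _).trans ?_)
    rw [← ENNReal.ofReal_mul (by positivity), mul_div_cancel₀ _ (by positivity)]
  have hlim : ∀ᵐ ω ∂P, Tendsto (fun m => g (X (roundUp m (κ ω)) ω) *
      (X (roundUp m (ρ ω)) ω - X (roundUp m (κ ω)) ω)) atTop
      (𝓝 (g (X (κ ω) ω) * (X (ρ ω) ω - X (κ ω) ω))) := by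
    filter_upwards [ae_tendsto_roundUp hc κ, ae_tendsto_roundUp hc ρ] with ω h1 h2
    exact ((hg.tendsto _).comp h1).mul (h2.sub h1)
  have hL := tendsto_Lp_finite_of_tendsto_ae le_rfl ENNReal.one_ne_top
    (fun m => (hgm m).mul ((hUρ.1 m).sub (hUκ.1 m))) (memLp_one_iff_integrable.2 hint) hprod hlim
  refine tendsto_nhds_unique (tendsto_integral_of_L1' _ hint.1 (Eventually.of_forall fun m => ?_) hL)
    ?_
  · exact (((hUρ.memLp m).integrable le_rfl).sub ((hUκ.memLp m).integrable le_rfl)).bdd_mul (c := c)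
      (hgm m) (ae_of_all _ fun ω => hgc _)
  · exact tendsto_const_nhds.congr fun m =>
      (hX.integral_roundUp_mul_sub_eq_zero hκ hρ hle hg hgc m).symm

end OptionalSampling

/-! ### Entrance times and the good-λ inequality -/

lemma Continuous.forall_le_of_forall_dense {f : I → ℝ} (hf : Continuous f) {Q : Set I}
    (hQ : Dense Q) {x y : I} (hxy : x < y) {c : ℝ}
    (h : ∀ u ∈ Q, u ∈ Set.Ioo x y → f u ≤ c) : ∀ u ∈ Set.Icc x y, f u ≤ c := by
  intro u hu
  rw [← closure_Ioo hxy.ne] at hu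
  have h1 : closure (Set.Ioo x y) ⊆ closure (Set.Ioo x y ∩ Q) :=
    closure_minimal (hQ.open_subset_closure_inter isOpen_Ioo) isClosed_closure
  refine (IsClosed.closure_subset_iff (isClosed_le hf continuous_const)).2 ?_ (h1 hu)
  exact fun v hv => h v hv.2 hv.1

section EntranceTime

variable {Ω : Type*} {mΩ : MeasurableSpace Ω} {𝓕 : Filtration I mΩ} {Q : Set I} {s t : I}
  {D D' : I → Set Ω} {ω : Ω}

/-- The first time in `Q ∩ (s, t)` (in the sense of infimum) at which `D` occurs, or `t`. -/
noncomputable def entranceTime (Q : Set I) (s t : I) (D : I → Set Ω) (ω : Ω) : I :=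
  sInf (insert t {u | u ∈ Q ∧ u ∈ Set.Ioo s t ∧ ω ∈ D u})

lemma entranceTime_le : entranceTime Q s t D ω ≤ t := sInf_le (Set.mem_insert _ _)

lemma entranceTime_le_of_mem {u : I} (hu : u ∈ Q) (hut : u ∈ Set.Ioo s t) (hω : ω ∈ D u) :
    entranceTime Q s t D ω ≤ u :=
  sInf_le (Set.mem_insert_of_mem _ ⟨hu, hut, hω⟩)

lemma le_entranceTime (hst : s ≤ t) : s ≤ entranceTime Q s t D ω := by
  refine le_sInf ?_
  rintro u (rfl | hu)
  · exact hst
  · exact hu.2.1.1.le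

lemma entranceTime_lt_iff {v : I} :
    entranceTime Q s t D ω < v ↔ t < v ∨ ∃ u ∈ Q, u ∈ Set.Ioo s t ∧ ω ∈ D u ∧ u < v := by
  rw [entranceTime, sInf_lt_iff]
  simp only [Set.mem_insert_iff, Set.mem_ofPred_eq]
  grind

lemma entranceTime_anti (h : ∀ u, D u ⊆ D' u) :
    entranceTime Q s t D' ω ≤ entranceTime Q s t D ω :=
  sInf_le_sInf <| Set.insert_subset_insert fun _ hu => ⟨hu.1, hu.2.1, h _ hu.2.2⟩

/-- Being strictly before `v` means that `D` has occurred at one of countably many times before `v`,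
or that `t < v`; hence no completeness or right-continuity is needed. -/
lemma isOptionalTime_entranceTime (hQ : Q.Countable)
    (hD : ∀ u, s ≤ u → MeasurableSet[𝓕 u] (D u)) :
    IsOptionalTime 𝓕 (entranceTime Q s t D) := by
  intro v
  have : {ω | entranceTime Q s t D ω < v} =
      {ω | t < v} ∪ ⋃ u ∈ Q ∩ (Set.Ioo s t ∩ Set.Iio v), D u := by
    ext ω
    simp only [Set.mem_ofPred_eq, entranceTime_lt_iff, Set.mem_union, Set.mem_iUnion, Set.mem_inter_iff,
      Set.mem_Iio]
    grind
  rw [this]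
  refine MeasurableSet.union (MeasurableSet.const _) ?_
  refine MeasurableSet.biUnion (hQ.mono Set.inter_subset_left) fun u hu => ?_
  exact 𝓕.mono hu.2.2.le _ (hD u hu.2.1.1.le)

end EntranceTime

lemma continuous_stoppedProcess_indicator {Ω : Type*} {X : I → Ω → ℝ} {ω : Ω}
    (h : Continuous fun t => X t ω) (τ : Ω → WithTop I) :
    Continuous fun t =>
      stoppedProcess (fun i => {ω | ⊥ < τ ω}.indicator (X i)) τ t ω := by
  by_cases h0 : ⊥ < τ ω
  · have h1 : ∀ i, {ω | ⊥ < τ ω}.indicator (X i) ω = X i ω := fun i =>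
      Set.indicator_of_mem (s := {ω | ⊥ < τ ω}) h0 _
    simp only [stoppedProcess, h1]
    cases hτ : τ ω with
    | top => simpa using h
    | coe c =>
      have : ∀ t : I, (min (t : WithTop I) c).untopA = min t c := fun t => by
        rw [← WithTop.coe_min]; rfl
      simp only [this]
      exact h.comp (continuous_id.min continuous_const)
  · have h1 : ∀ i, {ω | ⊥ < τ ω}.indicator (X i) ω = 0 := fun i =>
      Set.indicator_of_notMem (s := {ω | ⊥ < τ ω}) h0 _
    simp only [stoppedProcess, h1]
    exact continuous_const

lemma stoppedProcess_indicator_of_le {Ω : Type*} {X : I → Ω → ℝ} {ω : Ω} {τ : Ω → WithTop I}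
    (h0 : ⊥ < τ ω) {u : I} (hu : (u : WithTop I) ≤ τ ω) :
    stoppedProcess (fun i => {ω | ⊥ < τ ω}.indicator (X i)) τ u ω = X u ω := by
  rw [stoppedProcess_eq_of_le hu]
  exact Set.indicator_of_mem (s := {ω | ⊥ < τ ω}) h0 _

section GoodLambda

variable {Ω : Type*} {M A : I → Ω → ℝ} {τ τ' : Ω → WithTop I} {s t : I} {l a K : ℝ} {Q : Set I}

/-- The event that at time `u` one of the localizing times has passed, or one of the bounds
`|M s| ≤ K`, `|M u - M s| ≤ l`, `A u - A s ≤ a` fails. -/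
def exitEvent (M A : I → Ω → ℝ) (τ τ' : Ω → WithTop I) (s : I) (K a l : ℝ) (u : I) : Set Ω :=
  {ω | τ ω ≤ u ∨ τ' ω ≤ u ∨ K < |M s ω| ∨ a < A u ω - A s ω ∨ l < |M u ω - M s ω|}

lemma exitEvent_anti {l l' : ℝ} (h : l ≤ l') (u : I) :
    exitEvent M A τ τ' s K a l' u ⊆ exitEvent M A τ τ' s K a l u := by
  rintro ω (h1 | h1 | h1 | h1 | h1)
  · exact Or.inl h1
  · exact Or.inr (Or.inl h1)
  · exact Or.inr (Or.inr (Or.inl h1))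
  · exact Or.inr (Or.inr (Or.inr (Or.inl h1)))
  · exact Or.inr (Or.inr (Or.inr (Or.inr (h.trans_lt h1))))

lemma measurableSet_exitEvent {mΩ : MeasurableSpace Ω} {𝓕 : Filtration I mΩ}
    (hM : StronglyAdapted 𝓕 M) (hA : StronglyAdapted 𝓕 A)
    (hτ : IsStoppingTime 𝓕 τ) (hτ' : IsStoppingTime 𝓕 τ') {u : I} (hu : s ≤ u) :
    MeasurableSet[𝓕 u] (exitEvent M A τ τ' s K a l u) := by
  have hMu := (hM u).measurable
  have hMs := ((hM s).mono (𝓕.mono hu)).measurable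
  have hAu := (hA u).measurable
  have hAs := ((hA s).mono (𝓕.mono hu)).measurable
  refine (hτ u).union ((hτ' u).union (MeasurableSet.union ?_ (MeasurableSet.union ?_ ?_)))
  · exact measurableSet_lt measurable_const (continuous_abs.measurable.comp hMs)
  · exact measurableSet_lt measurable_const (hAu.sub hAs)
  · exact measurableSet_lt measurable_const (continuous_abs.measurable.comp (hMu.sub hMs))

/-- No bound fails at times of `Q` strictly between `s` and the entrance time; density and
continuity extend this to the closed interval. Positivity of `τ` and `τ'` disposes of the indicators
in the localized processes. -/
lemma le_of_lt_entranceTime {ω : Ω} (hQ : Dense Q)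
    (hM : Continuous fun u => M u ω) (hA : Continuous fun u => A u ω)
    (hs : s < entranceTime Q s t (exitEvent M A τ τ' s K a l) ω) :
    ⊥ < τ ω ∧ ⊥ < τ' ω ∧ entranceTime Q s t (exitEvent M A τ τ' s K a l) ω ≤ τ ω ∧
      entranceTime Q s t (exitEvent M A τ τ' s K a l) ω ≤ τ' ω ∧ |M s ω| ≤ K ∧
      ∀ u ∈ Set.Icc s (entranceTime Q s t (exitEvent M A τ τ' s K a l) ω),
        |M u ω - M s ω| ≤ l ∧ A u ω - A s ω ≤ a := by
  set ρ := entranceTime Q s t (exitEvent M A τ τ' s K a l) ω with hρ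
  have key : ∀ u ∈ Q, u ∈ Set.Ioo s ρ → ¬ (τ ω ≤ u ∨ τ' ω ≤ u ∨ K < |M s ω| ∨
      a < A u ω - A s ω ∨ l < |M u ω - M s ω|) := by
    intro u hu hsu hmem
    exact (hsu.2.trans_le (entranceTime_le_of_mem hu ⟨hsu.1, hsu.2.trans_le entranceTime_le⟩
      hmem)).false
  simp only [not_or, not_le, not_lt] at key
  obtain ⟨v, hvQ, hv⟩ := hQ.exists_between hs
  have hlow : ∀ τ₀ : WithTop I, (∀ u ∈ Q, u ∈ Set.Ioo s ρ → (u : WithTop I) < τ₀) →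
      (ρ : WithTop I) ≤ τ₀ := by
    intro τ₀ h
    cases τ₀ with
    | top => exact le_top
    | coe c =>
      refine WithTop.coe_le_coe.2 (le_of_not_gt fun hc => ?_)
      obtain ⟨u, huQ, hu⟩ := hQ.exists_between (max_lt hs hc)
      have := WithTop.coe_lt_coe.1 (h u huQ ⟨(le_max_left _ _).trans_lt hu.1, hu.2⟩)
      exact (((le_max_right s c).trans_lt hu.1).trans this).false
  refine ⟨bot_le.trans_lt (key v hvQ hv).1, bot_le.trans_lt (key v hvQ hv).2.1,
    hlow _ fun u hu h => (key u hu h).1, hlow _ fun u hu h => (key u hu h).2.1,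
    (key v hvQ hv).2.2.1, fun u hu => ⟨?_, ?_⟩⟩
  · exact (hM.sub continuous_const).abs.forall_le_of_forall_dense hQ hs
      (fun u hu h => (key u hu h).2.2.2.2) u hu
  · exact (hA.sub continuous_const).forall_le_of_forall_dense hQ hs
      (fun u hu h => (key u hu h).2.2.2.1) u hu

/-- If the increment were below `l` at the entrance time, it would stay so just afterwards. But exit
events occur at times of `Q` arbitrarily close to the right (or at the time itself), and here only
the increment of `M` can cause them. -/
lemma le_abs_sub_entranceTime {ω : Ω} (hM : Continuous fun u => M u ω)
    (hA : Monotone fun u => A u ω) (hτ : τ ω = ⊤) (hτ' : τ' ω = ⊤) (hK : |M s ω| ≤ K)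
    (hAt : A t ω - A s ω ≤ a) {u : I} (huQ : u ∈ Q) (hu : u ∈ Set.Ioo s t)
    (hul : l < |M u ω - M s ω|) :
    l ≤ |M (entranceTime Q s t (exitEvent M A τ τ' s K a l) ω) ω - M s ω| := by
  set ρ := entranceTime Q s t (exitEvent M A τ τ' s K a l) ω with hρ
  have hρt : ρ < t := (entranceTime_le_of_mem huQ hu (by simp [exitEvent, hul])).trans_lt hu.2
  by_contra! hlt
  have h1 : ∀ᶠ v in 𝓝 ρ, |M v ω - M s ω| < l :=
    ((hM.sub continuous_const).abs.tendsto ρ).eventually (gt_mem_nhds hlt)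
  obtain ⟨v, hv, hvs⟩ := exists_Ico_subset_of_mem_nhds h1 ⟨t, hρt⟩
  obtain h2 | ⟨w, hwQ, hw, hwD, hwv⟩ := entranceTime_lt_iff.1 (lt_min hv hρt)
  · exact (h2.trans_le (min_le_right _ _)).false
  · have hρw : ρ ≤ w := entranceTime_le_of_mem hwQ hw hwD
    have h3 : |M w ω - M s ω| < l := hvs ⟨hρw, hwv.trans_le (min_le_left _ _)⟩
    have h4 := hA hw.2.le
    simp only [exitEvent, Set.mem_ofPred_eq, hτ, hτ', top_le_iff, WithTop.coe_ne_top, false_or] at hwD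
    rcases hwD with h | h | h
    · exact h.not_ge hK
    · simp only at h4; linarith
    · linarith

end GoodLambda

section GoodLambda

variable {Ω : Type*} {mΩ : MeasurableSpace Ω} {P : Measure Ω} {𝓕 : Filtration I mΩ}
  {M A : I → Ω → ℝ} {τ τ' : Ω → WithTop I} {s t : I} {l a : ℝ} {Q : Set I}

/-- The event that the increment of `M` after time `s` exceeds `l` at some time in `Q ∩ (s, t)`. -/
def exceedEvent (M : I → Ω → ℝ) (Q : Set I) (s t : I) (l : ℝ) : Set Ω :=
  {ω | ∃ u ∈ Q, u ∈ Set.Ioo s t ∧ l < |M u ω - M s ω|}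

lemma measurableSet_exceedEvent (hM : ∀ u, Measurable (M u)) (hQ : Q.Countable) (s t : I) (l : ℝ) :
    MeasurableSet (exceedEvent M Q s t l) := by
  have : exceedEvent M Q s t l = ⋃ u ∈ Q ∩ Set.Ioo s t, {ω | l < |M u ω - M s ω|} := by
    ext ω; simp [exceedEvent, and_assoc]
  rw [this]
  exact MeasurableSet.biUnion (hQ.mono Set.inter_subset_left) fun u _ =>
    measurableSet_lt measurable_const (continuous_abs.measurable.comp ((hM u).sub (hM s)))

variable [IsProbabilityMeasure P]

/-- Compare the exits `κ ≤ ρ` at levels `l` and `2 * l`. Orthogonality and the martingale property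
of `M ^ 2 - A` equate the mean square of `M` between them with the mean growth of `A`. The former is
at least `l ^ 2` on the left-hand event; the latter is at most `a`, and vanishes unless level `l`
was exceeded. -/
lemma mul_measureReal_exceedEvent_inter_le (hM : StronglyAdapted 𝓕 M) (hA : StronglyAdapted 𝓕 A)
    (hMc : ∀ᵐ ω ∂P, Continuous fun u => M u ω) (hAc : ∀ᵐ ω ∂P, Continuous fun u => A u ω)
    (hAm : ∀ᵐ ω ∂P, Monotone fun u => A u ω)
    (hτ : IsStoppingTime 𝓕 τ) (hτ' : IsStoppingTime 𝓕 τ')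
    (hX : Martingale (stoppedProcess (fun u => {ω | ⊥ < τ ω}.indicator (M u)) τ) 𝓕 P)
    (hY : Martingale (stoppedProcess
      (fun u => {ω | ⊥ < τ' ω}.indicator (fun ω => M u ω ^ 2 - A u ω)) τ') 𝓕 P)
    (hQ : Dense Q) (hQc : Q.Countable) (hst : s < t) (hl : 0 < l) (ha : 0 ≤ a) (K : ℝ) :
    l ^ 2 * P.real (exceedEvent M Q s t (2 * l) ∩ {ω | A t ω - A s ω ≤ a} ∩
        ({ω | τ ω = ⊤} ∩ {ω | τ' ω = ⊤} ∩ {ω | |M s ω| ≤ K})) ≤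
      a * P.real (exceedEvent M Q s t l) := by
  set ρ := entranceTime Q s t (exitEvent M A τ τ' s K a (2 * l)) with hρdef
  set κ := entranceTime Q s t (exitEvent M A τ τ' s K a l) with hκdef
  set X := stoppedProcess (fun u => {ω | ⊥ < τ ω}.indicator (M u)) τ with hXdef
  set Y := stoppedProcess
    (fun u => {ω | ⊥ < τ' ω}.indicator (fun ω => M u ω ^ 2 - A u ω)) τ' with hYdef
  have hl2 : l ≤ 2 * l := by linarith
  have hκρ : κ ≤ ρ := fun ω => entranceTime_anti fun u => exitEvent_anti hl2 u
  have hρ : IsOptionalTime 𝓕 ρ :=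
    isOptionalTime_entranceTime hQc fun u hu => measurableSet_exitEvent hM hA hτ hτ' hu
  have hκ : IsOptionalTime 𝓕 κ :=
    isOptionalTime_entranceTime hQc fun u hu => measurableSet_exitEvent hM hA hτ hτ' hu
  have hXc : ∀ᵐ ω ∂P, Continuous fun u => X u ω := by
    filter_upwards [hMc] with ω h using continuous_stoppedProcess_indicator h τ
  have hYc : ∀ᵐ ω ∂P, Continuous fun u => Y u ω := by
    filter_upwards [hMc, hAc] with ω h1 h2
    exact continuous_stoppedProcess_indicator (X := fun u ω => M u ω ^ 2 - A u ω)
      ((h1.pow 2).sub h2) τ'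
  set c := |K| + 2 * l with hc
  have hc0 : 0 ≤ c := by positivity
  -- Clipping makes the weight bounded, and changes nothing at `M κ` when `κ < ρ`.
  set g : ℝ → ℝ := fun x => max (-c) (min x c) with hg
  have hgc : Continuous g := by fun_prop
  have hgb : ∀ x, ‖g x‖ ≤ c := fun x =>
    abs_le.2 ⟨le_max_left _ _, max_le (by linarith) (min_le_right _ _)⟩
  obtain ⟨hi1, hI1⟩ := hX.integral_optionalTime_mul_sub_eq_zero hXc hκ hρ hκρ hgc hgb
  obtain ⟨hi2, hI2⟩ := hY.integral_optionalTime_mul_sub_eq_zero hYc hκ hρ hκρ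
    (g := fun _ => 1) continuous_const (c := 1) (by simp)
  simp only [one_mul] at hi2 hI2
  set E₁ := exceedEvent M Q s t (2 * l) ∩ {ω | A t ω - A s ω ≤ a} ∩
        ({ω | τ ω = ⊤} ∩ {ω | τ' ω = ⊤} ∩ {ω | |M s ω| ≤ K}) with hE₁
  set E₂ := exceedEvent M Q s t l with hE₂
  have hMm : ∀ u, Measurable (M u) := fun u => ((hM u).mono (𝓕.le u)).measurable
  have hAmeas : ∀ u, Measurable (A u) := fun u => ((hA u).mono (𝓕.le u)).measurable
  have hE₁m : MeasurableSet E₁ := by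
    refine ((measurableSet_exceedEvent hMm hQc _ _ _).inter
      (measurableSet_le ((hAmeas t).sub (hAmeas s)) measurable_const)).inter
        (((hτ.measurable' (measurableSet_singleton ⊤)).inter
          (hτ'.measurable' (measurableSet_singleton ⊤))).inter
            (measurableSet_le (continuous_abs.measurable.comp (hMm s)) measurable_const))
  have hE₂m : MeasurableSet E₂ := measurableSet_exceedEvent hMm hQc _ _ _
  -- For `κ < ρ` this is `(M ρ - M κ) ^ 2 = M ρ ^ 2 - M κ ^ 2 - 2 * M κ * (M ρ - M κ)`; for `κ = ρ`
  -- the right side is zero and `E₁` is impossible.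
  have hpt : ∀ᵐ ω ∂P, E₁.indicator (fun _ => l ^ 2) ω - E₂.indicator (fun _ => a) ω ≤
      (Y (ρ ω) ω - Y (κ ω) ω) - 2 * (g (X (κ ω) ω) * (X (ρ ω) ω - X (κ ω) ω)) := by
    filter_upwards [hMc, hAc, hAm] with ω hMω hAω hmono
    have hsκ : s ≤ κ ω := le_entranceTime hst.le
    have hMκ : |M (κ ω) ω - M s ω| ≤ l := by
      rcases hsκ.eq_or_lt with h | h
      · simp [← h, hl.le]
      · exact ((le_of_lt_entranceTime hQ hMω hAω h).2.2.2.2.2 _ ⟨hsκ, le_rfl⟩).1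
    have hE₁' : ω ∈ E₁ → 2 * l ≤ |M (ρ ω) ω - M s ω| := by
      rintro ⟨⟨⟨u, huQ, hu, hul⟩, hAt⟩, ⟨h1, h2⟩, h3⟩
      exact le_abs_sub_entranceTime hMω hmono h1 h2 h3 hAt huQ hu hul
    rcases (hκρ ω).eq_or_lt with h | h
    · have : ω ∉ E₁ := fun h' => by
        have := hE₁' h'
        rw [← h] at this
        linarith
      rw [Set.indicator_of_notMem this, h]
      have : 0 ≤ E₂.indicator (fun _ => a) ω := Set.indicator_nonneg (fun _ _ => ha) _
      simpa using this
    · have hsρ : s < ρ ω := hsκ.trans_lt h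
      obtain ⟨h0, h0', hρτ, hρτ', hMs, hb⟩ := le_of_lt_entranceTime hQ hMω hAω hsρ
      have hκτ : (κ ω : WithTop I) ≤ τ ω := (WithTop.coe_le_coe.2 h.le).trans hρτ
      have hκτ' : (κ ω : WithTop I) ≤ τ' ω := (WithTop.coe_le_coe.2 h.le).trans hρτ'
      have e1 : X (ρ ω) ω = M (ρ ω) ω := stoppedProcess_indicator_of_le h0 hρτ
      have e2 : X (κ ω) ω = M (κ ω) ω := stoppedProcess_indicator_of_le h0 hκτ
      have e3 : Y (ρ ω) ω = M (ρ ω) ω ^ 2 - A (ρ ω) ω :=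
        stoppedProcess_indicator_of_le (X := fun u ω => M u ω ^ 2 - A u ω) h0' hρτ'
      have e4 : Y (κ ω) ω = M (κ ω) ω ^ 2 - A (κ ω) ω :=
        stoppedProcess_indicator_of_le (X := fun u ω => M u ω ^ 2 - A u ω) h0' hκτ'
      have hgκ : g (M (κ ω) ω) = M (κ ω) ω := by
        have h1 : |M (κ ω) ω| ≤ c := by
          have := abs_sub_abs_le_abs_sub (M (κ ω) ω) (M s ω)
          have := le_abs_self K
          linarith
        rw [abs_le] at h1
        simp only [hg]
        rw [min_eq_left h1.2, max_eq_right h1.1]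
      -- The other causes of exit are common to `κ` and `ρ`, so only the level `l` can separate
      -- them.
      have hω₂ : ω ∈ E₂ := by
        obtain h1 | ⟨u, huQ, hu, huD, huρ⟩ := entranceTime_lt_iff.1 h
        · exact absurd h1 (entranceTime_le (D := exitEvent M A τ τ' s K a (2 * l))).not_gt
        · refine ⟨u, huQ, hu, ?_⟩
          rcases huD with h2 | h2 | h2 | h2 | h2
          · exact absurd (h2.trans_lt (WithTop.coe_lt_coe.2 huρ)) hρτ.not_gt
          · exact absurd (h2.trans_lt (WithTop.coe_lt_coe.2 huρ)) hρτ'.not_gt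
          · exact absurd h2 hMs.not_gt
          · exact absurd h2 (hb u ⟨hu.1.le, huρ.le⟩).2.not_gt
          · exact h2
      have hAκ : A s ω ≤ A (κ ω) ω := hmono hsκ
      have hAρ := (hb (ρ ω) ⟨hsρ.le, le_rfl⟩).2
      have hsq : E₁.indicator (fun _ => l ^ 2) ω ≤ (M (ρ ω) ω - M (κ ω) ω) ^ 2 := by
        refine Set.indicator_apply_le' (fun h' => ?_) fun _ => sq_nonneg _
        have h1 := hE₁' h'
        have h2 : l ≤ |M (ρ ω) ω - M (κ ω) ω| := by
          have := abs_sub_abs_le_abs_sub (M (ρ ω) ω - M s ω) (M (κ ω) ω - M s ω)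
          rw [sub_sub_sub_cancel_right] at this
          linarith
        rw [← sq_abs (M (ρ ω) ω - M (κ ω) ω)]
        gcongr
      rw [Set.indicator_of_mem hω₂, e1, e2, e3, e4, hgκ]
      linarith [sq_nonneg (M (ρ ω) ω - M (κ ω) ω)]
  have hint := integral_mono_ae (((integrable_const _).indicator hE₁m).sub
    ((integrable_const _).indicator hE₂m)) (hi2.sub (hi1.const_mul 2)) hpt
  simp only [Pi.sub_apply] at hint
  rw [integral_sub ((integrable_const _).indicator hE₁m) ((integrable_const _).indicator hE₂m),
    integral_sub hi2 (hi1.const_mul 2), integral_const_mul, hI1, hI2,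
    integral_indicator_const _ hE₁m, integral_indicator_const _ hE₂m] at hint
  simp only [smul_eq_mul] at hint
  linarith

/-- A good-λ inequality between a continuous local martingale and its bracket. -/
theorem mul_measureReal_exceedEvent_le (hM : StronglyAdapted 𝓕 M) (hA : StronglyAdapted 𝓕 A)
    (hAm : ∀ᵐ ω ∂P, Monotone fun u => A u ω)
    (hlM : IsContinuousLocalMartingale P 𝓕 M)
    (hlA : IsContinuousLocalMartingale P 𝓕 fun u ω => M u ω ^ 2 - A u ω)
    (hQ : Dense Q) (hQc : Q.Countable) (hst : s < t) (hl : 0 < l) (ha : 0 ≤ a) :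
    l ^ 2 * P.real (exceedEvent M Q s t (2 * l) ∩ {ω | A t ω - A s ω ≤ a}) ≤
      a * P.real (exceedEvent M Q s t l) := by
  have hMc := hlM.continuous_paths
  have hAc : ∀ᵐ ω ∂P, Continuous fun u => A u ω := by
    filter_upwards [hMc, hlA.continuous_paths] with ω h1 h2
    exact ((h1.pow 2).sub h2).congr fun u => by simp
  obtain ⟨τ, hτ, hX⟩ := hlM.locally_martingale
  obtain ⟨τ', hτ', hY⟩ := hlA.locally_martingale
  have hMm : ∀ u, Measurable (M u) := fun u => ((hM u).mono (𝓕.le u)).measurable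
  have hAmeas : ∀ u, Measurable (A u) := fun u => ((hA u).mono (𝓕.le u)).measurable
  set E := exceedEvent M Q s t (2 * l) ∩ {ω | A t ω - A s ω ≤ a} with hE
  -- Almost every path is eventually in `F n`, which removes both the localization and the bound on
  -- `M s`.
  set F : ℕ → Set Ω := fun n => {ω | τ n ω = ⊤} ∩ {ω | τ' n ω = ⊤} ∩ {ω | |M s ω| ≤ n} with hF
  have hEm : MeasurableSet E := (measurableSet_exceedEvent hMm hQc _ _ _).inter
      (measurableSet_le ((hAmeas t).sub (hAmeas s)) measurable_const)
  have hFm : ∀ n, MeasurableSet (F n) := fun n =>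
    ((((hτ.isStoppingTime n).measurable' (measurableSet_singleton ⊤)).inter
      ((hτ'.isStoppingTime n).measurable' (measurableSet_singleton ⊤))).inter
        (measurableSet_le (continuous_abs.measurable.comp (hMm s)) measurable_const))
  have htop : ∀ {x : ℕ → WithTop I}, Tendsto x atTop (𝓝 ⊤) → ∀ᶠ n in atTop, x n = ⊤ := by
    intro x hx
    filter_upwards [(WithTop.tendsto_nhds_top_iff x).1 hx 1] with n hn
    cases h : x n with
    | top => rfl
    | coe c =>
      rw [h] at hn
      exact absurd (WithTop.coe_lt_coe.1 hn) unitInterval.le_one'.not_gt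
  have hlim : Tendsto (fun n => P (E ∩ F n)) atTop (𝓝 (P E)) := by
    refine tendsto_measure_of_ae_tendsto_indicator atTop hEm (fun n => hEm.inter (hFm n)) hEm
      (measure_ne_top _ _) (Eventually.of_forall fun n => Set.inter_subset_left) ?_
    filter_upwards [hτ.tendsto_top, hτ'.tendsto_top] with ω h1 h2
    filter_upwards [htop h1, htop h2, eventually_ge_atTop ⌈|M s ω|⌉₊] with n h3 h4 h5
    exact and_iff_left ⟨⟨h3, h4⟩, Nat.ceil_le.1 h5⟩
  have hlim' : Tendsto (fun n => P.real (E ∩ F n)) atTop (𝓝 (P.real E)) :=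
    (ENNReal.tendsto_toReal (measure_ne_top _ _)).comp hlim
  refine le_of_tendsto (hlim'.const_mul (l ^ 2)) (Eventually.of_forall fun n => ?_)
  exact mul_measureReal_exceedEvent_inter_le hM hA hMc hAc hAm (hτ.isStoppingTime n)
    (hτ'.isStoppingTime n) (hX n) (hY n) hQ hQc hst hl ha n

end GoodLambda

/-! ### A tail bound for increments of continuous local martingales -/

/-- Unfolding gives a geometric series of ratio `δ * r = 1 / 4`, hence the `4 / 3`; the remainder `δ
^ J * x J` vanishes because `x` is bounded. -/
lemma le_of_geometric_recursion {x : ℕ → ℝ} {c r δ : ℝ} (hx : ∀ j, x j ≤ 1)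
    (hδ : 0 ≤ δ) (hδ1 : δ < 1) (hδr : δ * r = 1 / 4) (hc : 0 ≤ c)
    (h : ∀ j, x j ≤ c * r ^ j + δ * x (j + 1)) : x 0 ≤ 4 / 3 * c := by
  have key : ∀ J : ℕ, x 0 ≤ c * (4 / 3 * (1 - (1 / 4) ^ J)) + δ ^ J * x J := by
    intro J
    induction J with
    | zero => simp
    | succ J ih =>
      have h1 := mul_le_mul_of_nonneg_left (h J) (pow_nonneg hδ J)
      have h2 : δ ^ J * (c * r ^ J) = c * (1 / 4) ^ J := by
        rw [← hδr, mul_pow]; ring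
      rw [pow_succ, pow_succ]
      linarith
  have hlim : Tendsto (fun J : ℕ => 4 / 3 * c + δ ^ J) atTop (𝓝 (4 / 3 * c + 0)) :=
    tendsto_const_nhds.add (tendsto_pow_atTop_nhds_zero_of_lt_one hδ hδ1)
  rw [add_zero] at hlim
  refine ge_of_tendsto hlim (Eventually.of_forall fun J => (key J).trans ?_)
  have h1 : δ ^ J * x J ≤ δ ^ J := mul_le_of_le_one_right (pow_nonneg hδ J) (hx J)
  have h2 : 0 ≤ c * (1 / 4) ^ J := by positivity
  linarith

section TailBound

variable {Ω : Type*} {mΩ : MeasurableSpace Ω}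

lemma measureReal_lt_le_div {P : Measure Ω} [IsProbabilityMeasure P] {Z : Ω → ℝ}
    (hZ : Measurable Z) {b : ℝ} (hb : 0 < b) (hb1 : b ≤ 1) (p : ℕ) :
    P.real {ω | b < Z ω} ≤ (∫⁻ ω, min 1 (ENNReal.ofReal (Z ω)) ^ p ∂P).toReal * (b⁻¹) ^ p := by
  have hfin : ∫⁻ ω, min 1 (ENNReal.ofReal (Z ω)) ^ p ∂P ≠ ∞ := by
    refine ((lintegral_mono fun ω => pow_le_one' (min_le_left _ _) p).trans_lt ?_).ne
    simp
  have h1 := mul_meas_ge_le_lintegral₀ (μ := P)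
    (f := fun ω => min 1 (ENNReal.ofReal (Z ω)) ^ p) (by fun_prop) (ENNReal.ofReal b ^ p)
  have h2 : ENNReal.ofReal b ^ p * P {ω | b < Z ω} ≤
      ∫⁻ ω, min 1 (ENNReal.ofReal (Z ω)) ^ p ∂P := by
    refine le_trans ?_ h1
    gcongr
    rename_i ω
    intro hω
    refine pow_le_pow_left' (le_min ?_ (ENNReal.ofReal_le_ofReal (le_of_lt hω))) p
    simpa using ENNReal.ofReal_le_ofReal hb1
  have h3 := ENNReal.toReal_mono hfin h2
  rw [ENNReal.toReal_mul, ENNReal.toReal_pow, ENNReal.toReal_ofReal hb.le] at h3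
  rw [inv_pow, ← div_eq_mul_inv, le_div_iff₀ (by positivity), mul_comm]
  exact h3

/-- The probability that a continuous local martingale moves by more than `ε` on an interval is
controlled by truncated moments of the increment of its bracket. -/
theorem exists_measure_exceedEvent_le (p : ℕ) {ε : ℝ} (hε : 0 < ε) :
    ∃ C : ℝ≥0, ∀ {Ω : Type*} {mΩ : MeasurableSpace Ω} {P : Measure Ω} [IsProbabilityMeasure P]
      {𝓕 : Filtration I mΩ} {M A : I → Ω → ℝ} {Q : Set I} {s t : I},
      StronglyAdapted 𝓕 M → StronglyAdapted 𝓕 A →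
      (∀ᵐ ω ∂P, Monotone fun u => A u ω) →
      IsContinuousLocalMartingale P 𝓕 M →
      IsContinuousLocalMartingale P 𝓕 (fun u ω => M u ω ^ 2 - A u ω) →
      Dense Q → Q.Countable → s < t →
      P (exceedEvent M Q s t ε) ≤
        C * ∫⁻ ω, min 1 (ENNReal.ofReal (A t ω - A s ω)) ^ p ∂P := by
  -- Levels at most `1` keep the thresholds `δ * l ^ 2` below the truncation of the moment.
  set ε' := min ε 1 with hε'
  have hε'0 : 0 < ε' := lt_min hε one_pos
  -- Halving the level multiplies the Markov term by `4 ^ p`; this `δ` beats that growth, leaving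
  -- ratio `1 / 4`.
  set δ : ℝ := (1 / 4) ^ (p + 1) with hδ
  have hδ0 : 0 < δ := by positivity
  have hδ1 : δ < 1 := pow_lt_one₀ (by norm_num) (by norm_num) (by simp)
  set B : ℝ := ((δ * ε' ^ 2 / 4)⁻¹) ^ p with hB
  have hB0 : 0 ≤ B := by positivity
  refine ⟨(4 / 3 * B).toNNReal, ?_⟩
  intro Ω mΩ P _ 𝓕 M A Q s t hM hA hAm hlM hlA hQ hQc hst
  have hMm : ∀ u, Measurable (M u) := fun u => ((hM u).mono (𝓕.le u)).measurable
  have hAmeas : ∀ u, Measurable (A u) := fun u => ((hA u).mono (𝓕.le u)).measurable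
  set G := (∫⁻ ω, min 1 (ENNReal.ofReal (A t ω - A s ω)) ^ p ∂P) with hG
  have hfin : G ≠ ∞ := by
    refine ((lintegral_mono fun ω => pow_le_one' (min_le_left _ _) p).trans_lt ?_).ne
    simp
  have hrec : ∀ j : ℕ, P.real (exceedEvent M Q s t (ε' * (1 / 2) ^ j)) ≤
      G.toReal * B * (4 ^ p) ^ j + δ * P.real (exceedEvent M Q s t (ε' * (1 / 2) ^ (j + 1))) := by
    intro j
    set l := ε' * (1 / 2 : ℝ) ^ (j + 1) with hl
    have hl0 : 0 < l := by positivity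
    have hl2 : ε' * (1 / 2) ^ j = 2 * l := by rw [hl, pow_succ]; ring
    rw [hl2]
    have hl1 : l ≤ 1 := by
      have h1 : ((1 : ℝ) / 2) ^ (j + 1) ≤ 1 := pow_le_one₀ (by norm_num) (by norm_num)
      have h2 : ε' ≤ 1 := min_le_right _ _
      exact mul_le_one₀ h2 (by positivity) h1
    have hb0 : 0 < δ * l ^ 2 := by positivity
    have hgood := mul_measureReal_exceedEvent_le hM hA hAm hlM hlA hQ hQc hst hl0 hb0.le
    have h1 : P.real (exceedEvent M Q s t (2 * l) ∩ {ω | A t ω - A s ω ≤ δ * l ^ 2}) ≤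
        δ * P.real (exceedEvent M Q s t l) := by
      refine le_of_mul_le_mul_left (hgood.trans_eq ?_) (pow_pos hl0 2)
      ring
    have h2 := measureReal_lt_le_div (P := P) ((hAmeas t).sub (hAmeas s)) hb0
      (mul_le_one₀ hδ1.le (by positivity) (pow_le_one₀ hl0.le hl1)) p
    have h3 : ((δ * l ^ 2)⁻¹) ^ p = B * (4 ^ p) ^ j := by
      rw [hB, ← pow_mul, mul_comm p j, pow_mul, ← mul_pow]
      congr 1
      have : ((1 : ℝ) / 2) ^ (j + 1) = (2 * 2 ^ j)⁻¹ := by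
        rw [one_div, inv_pow, pow_succ, mul_comm]
      have h4 : (4 : ℝ) ^ j = 2 ^ j * 2 ^ j := by rw [← mul_pow]; norm_num
      rw [hl, this, h4]
      field_simp
      norm_num
    calc P.real (exceedEvent M Q s t (2 * l))
        ≤ P.real (exceedEvent M Q s t (2 * l) ∩ {ω | A t ω - A s ω ≤ δ * l ^ 2} ∪
            {ω | δ * l ^ 2 < A t ω - A s ω}) := by
          refine measureReal_mono fun ω hω => ?_
          rcases le_or_gt (A t ω - A s ω) (δ * l ^ 2) with h | h
          · exact Or.inl ⟨hω, h⟩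
          · exact Or.inr h
      _ ≤ _ := measureReal_union_le _ _
      _ ≤ δ * P.real (exceedEvent M Q s t l) + G.toReal * ((δ * l ^ 2)⁻¹) ^ p := add_le_add h1 h2
      _ = _ := by rw [h3]; ring
  have hmain := le_of_geometric_recursion
    (x := fun j => P.real (exceedEvent M Q s t (ε' * (1 / 2) ^ j)))
    (fun j => measureReal_le_one) hδ0.le hδ1 (r := 4 ^ p)
    (by rw [hδ, pow_succ, mul_right_comm, ← mul_pow]; norm_num) (by positivity) hrec
  simp only [pow_zero, mul_one] at hmain
  calc P (exceedEvent M Q s t ε) ≤ P (exceedEvent M Q s t ε') :=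
        measure_mono fun ω ⟨u, h1, h2, h3⟩ => ⟨u, h1, h2, (min_le_left _ _).trans_lt h3⟩
    _ = ENNReal.ofReal (P.real (exceedEvent M Q s t ε')) := (ofReal_measureReal).symm
    _ ≤ ENNReal.ofReal (4 / 3 * B * G.toReal) :=
        ENNReal.ofReal_le_ofReal (hmain.trans_eq (by ring))
    _ = _ := by
        rw [ENNReal.ofReal_mul (by positivity), ENNReal.ofReal_toReal hfin]
        rfl

end TailBound

/-! ### Consequences of superlinear growth -/

section Growth

variable {Θ : ℝ≥0 → ℝ≥0}

lemma exists_mul_le_of_tendsto_div (hΘ : Tendsto (fun x => Θ x / x) atTop atTop) (L : ℝ≥0) :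
    ∃ R : ℝ≥0, 0 < R ∧ ∀ x, R ≤ x → L * x ≤ Θ x := by
  obtain ⟨R, hR⟩ := eventually_atTop.1 (hΘ.eventually_ge_atTop L)
  refine ⟨max R 1, by positivity, fun x hx => ?_⟩
  have hx0 : 0 < x := one_pos.trans_le ((le_max_right _ _).trans hx)
  exact (le_div_iff₀ hx0).1 (hR x ((le_max_left _ _).trans hx))

/-- A doubling superlinear function dominates a power on bounded sets. -/
lemma exists_pow_le_mul (hΘ : Tendsto (fun x => Θ x / x) atTop atTop)
    (hd : ∃ C : ℝ≥0, ∀ x, Θ (2 * x) ≤ C * Θ x) :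
    ∃ p : ℕ, 2 ≤ p ∧ ∀ R : ℝ≥0, ∃ C : ℝ≥0, ∀ x ≤ R, x ^ p ≤ C * Θ x := by
  obtain ⟨C, hC⟩ := hd
  -- The exponent `q + 2` ensures both `C ≤ 2 ^ p` and `2 ≤ p`.
  obtain ⟨q, hq⟩ := pow_unbounded_of_one_lt C (one_lt_two : (1 : ℝ≥0) < 2)
  refine ⟨q + 2, by omega, fun R' => ?_⟩
  set p := q + 2 with hp
  have hCp : C ≤ 2 ^ p := hq.le.trans (pow_le_pow_right₀ one_le_two (by omega))
  obtain ⟨R, hR0, hR⟩ := exists_mul_le_of_tendsto_div hΘ 1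
  set T := max R' (2 * R) with hT
  have hT0 : 0 < T := (mul_pos two_pos hR0).trans_le (le_max_right _ _)
  have hbase : ∀ x, R < x → x ≤ T → x ^ p ≤ T ^ p / R * Θ x := by
    intro x hx hxT
    have h1 : x ^ p ≤ T ^ p := pow_le_pow_left₀ zero_le hxT p
    have h2 : R ≤ Θ x := hx.le.trans ((one_mul x).symm.trans_le (hR x hx.le))
    calc x ^ p ≤ T ^ p := h1
      _ = T ^ p / R * R := (div_mul_cancel₀ _ hR0.ne').symm
      _ ≤ _ := by gcongr
  -- Double `x` until it exceeds `R`: each doubling gains `2 ^ p` on the left and at most `C ≤ 2 ^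
  -- p` on the right, so the constant never degrades. Since `2 * R ≤ T`, doubling stays within
  -- range.
  have hstep : ∀ k : ℕ, ∀ x ≤ T, R < 2 ^ k * x → x ^ p ≤ T ^ p / R * Θ x := by
    intro k
    induction k with
    | zero => intro x hxT hx; exact hbase x (by simpa using hx) hxT
    | succ k ih =>
      intro x hxT hx
      rcases lt_or_ge R x with h | h
      · exact hbase x h hxT
      · have h1 := ih (2 * x) ((mul_le_mul_right h 2).trans (le_max_right _ _))
          (by rwa [← mul_assoc, ← pow_succ])
        rw [mul_pow] at h1
        have h2 : 2 ^ p * x ^ p ≤ 2 ^ p * (T ^ p / R * Θ x) := by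
          calc 2 ^ p * x ^ p ≤ T ^ p / R * Θ (2 * x) := h1
            _ ≤ T ^ p / R * (2 ^ p * Θ x) := by
                gcongr
                exact (hC x).trans (by gcongr)
            _ = _ := by ring
        exact le_of_mul_le_mul_left h2 (by positivity)
  refine ⟨T ^ p / R, fun x hx => ?_⟩
  rcases eq_or_ne x 0 with rfl | hx0
  · simp [hp]
  · obtain ⟨k, hk⟩ := pow_unbounded_of_one_lt (R / x) (one_lt_two : (1 : ℝ≥0) < 2)
    exact hstep k x (hx.trans (le_max_left _ _)) ((div_lt_iff₀ (pos_of_ne_zero hx0)).1 hk)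

/-- Hölder's inequality gives the factor `μ univ ^ (p - 1)`, which is at most `h` because `p ≥ 2`
and `h ≤ 1`. -/
lemma pow_lintegral_le {α : Type*} [MeasurableSpace α] {μ : Measure α} {f : α → ℝ≥0∞}
    (hf : Measurable f) {p : ℕ} (hp : 2 ≤ p) {h : ℝ≥0} (hh : h ≤ 1) (hμ : μ Set.univ ≤ h) :
    (∫⁻ x, f x ∂μ) ^ p ≤ h * ∫⁻ x, f x ^ p ∂μ := by
  have hp0 : (p : ℝ) ≠ 0 := by positivity
  have h1 := eLpNorm_le_eLpNorm_mul_rpow_measure_univ (μ := μ) (p := 1) (q := p)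
    (by exact_mod_cast (show 1 ≤ p by omega)) hf.aestronglyMeasurable
  rw [eLpNorm_one_eq_lintegral_enorm,
    eLpNorm_eq_lintegral_rpow_enorm_toReal (by positivity) (by simp)] at h1
  simp only [enorm_eq_self, ENNReal.toReal_one, ENNReal.toReal_natCast, ENNReal.rpow_natCast,
    div_one] at h1
  calc (∫⁻ x, f x ∂μ) ^ p
      ≤ ((∫⁻ x, f x ^ p ∂μ) ^ (1 / (p : ℝ)) * μ Set.univ ^ (1 - 1 / (p : ℝ))) ^ p := by gcongr
    _ = (∫⁻ x, f x ^ p ∂μ) * μ Set.univ ^ (p - 1) := by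
        rw [mul_pow, ← ENNReal.rpow_natCast, ← ENNReal.rpow_mul, one_div_mul_cancel hp0,
          ENNReal.rpow_one, ← ENNReal.rpow_natCast (μ Set.univ ^ _), ← ENNReal.rpow_mul, sub_mul,
          one_div_mul_cancel hp0, one_mul, ← ENNReal.rpow_natCast _ (p - 1),
          Nat.cast_sub (by omega), Nat.cast_one]
    _ ≤ (∫⁻ x, f x ^ p ∂μ) * h := by
        gcongr
        calc μ Set.univ ^ (p - 1) ≤ (h : ℝ≥0∞) ^ (p - 1) := by gcongr
          _ ≤ (h : ℝ≥0∞) ^ 1 := pow_le_pow_right_of_le_one' (by exact_mod_cast hh) (by omega)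
          _ = h := pow_one _
    _ = _ := mul_comm _ _

lemma ENNReal.add_pow_le_two_pow_mul (a b : ℝ≥0∞) (p : ℕ) :
    (a + b) ^ p ≤ 2 ^ p * (a ^ p + b ^ p) := by
  have h : a + b ≤ 2 * max a b := by
    rw [two_mul]; exact add_le_add (le_max_left _ _) (le_max_right _ _)
  calc (a + b) ^ p ≤ (2 * max a b) ^ p := by gcongr
    _ = 2 ^ p * max a b ^ p := mul_pow _ _ _
    _ ≤ _ := by
      gcongr
      rcases le_total a b with hab | hab
      · rw [max_eq_right hab]; exact le_add_self
      · rw [max_eq_left hab]; exact le_self_add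

/-- On sets of small measure, a truncated power of `∫ f` is controlled by a small multiple of
`∫ Θ ∘ f`. -/
lemma exists_min_one_pow_lintegral_le (hm : Measurable Θ)
    (hΘ : Tendsto (fun x => Θ x / x) atTop atTop)
    {p : ℕ} (hp : 2 ≤ p) (hpow : ∀ R : ℝ≥0, ∃ C : ℝ≥0, ∀ x ≤ R, x ^ p ≤ C * Θ x)
    {η : ℝ≥0} (hη : 0 < η) :
    ∃ h : ℝ≥0, 0 < h ∧ ∀ {α : Type*} [MeasurableSpace α] (μ : Measure α) (f : α → ℝ≥0),
      Measurable f → μ Set.univ ≤ h →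
        min 1 (∫⁻ x, f x ∂μ) ^ p ≤ η * ∫⁻ x, Θ (f x) ∂μ := by
  set L : ℝ≥0 := 2 ^ (p + 1) / η with hL
  have hL0 : 0 < L := by positivity
  obtain ⟨R, -, hR⟩ := exists_mul_le_of_tendsto_div hΘ L
  obtain ⟨C, hC⟩ := hpow R
  set h : ℝ≥0 := min 1 (η / (2 ^ (p + 1) * (C + 1))) with hh
  refine ⟨h, lt_min one_pos (by positivity), ?_⟩
  intro α _ μ f hf hμ
  have hms : MeasurableSet {x | f x ≤ R} := measurableSet_le hf measurable_const
  -- Values up to `R` are handled by the power bound and the small measure, larger values by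
  -- superlinearity; `h` and `L` give each part half of `η`.
  set a := ∫⁻ x, {x | f x ≤ R}.indicator (fun x => (f x : ℝ≥0∞)) x ∂μ with ha
  set b := ∫⁻ x, {x | f x ≤ R}ᶜ.indicator (fun x => (f x : ℝ≥0∞)) x ∂μ with hb
  set T := ∫⁻ x, (Θ (f x) : ℝ≥0∞) ∂μ with hT
  have hab : ∫⁻ x, f x ∂μ = a + b := by
    rw [ha, hb, ← lintegral_add_left (hf.coe_nnreal_ennreal.indicator hms)]
    refine lintegral_congr fun x => ?_
    exact (congrFun (Set.indicator_self_add_compl {x | f x ≤ R}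
      (fun x => (f x : ℝ≥0∞))) x).symm
  have h1 : a ^ p ≤ (h * C : ℝ≥0) * T := by
    refine (pow_lintegral_le (hf.coe_nnreal_ennreal.indicator hms) hp (min_le_left _ _) hμ).trans ?_
    rw [ENNReal.coe_mul, mul_assoc]
    gcongr
    rw [hT, ← lintegral_const_mul _ (by fun_prop)]
    refine lintegral_mono fun x => ?_
    by_cases hx : f x ≤ R
    · rw [Set.indicator_of_mem (by exact hx)]
      simpa only [ENNReal.coe_pow, ENNReal.coe_mul] using ENNReal.coe_le_coe.2 (hC _ hx)
    · rw [Set.indicator_of_notMem (by exact hx), zero_pow (by omega)]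
      exact zero_le
  have h2 : b ≤ (L⁻¹ : ℝ≥0) * T := by
    rw [← lintegral_const_mul _ (by fun_prop)]
    refine lintegral_mono fun x => ?_
    refine Set.indicator_apply_le' (fun hx => ?_) fun _ => zero_le
    have hx' : R ≤ f x := le_of_not_ge hx
    have := hR _ hx'
    have h3 : f x ≤ L⁻¹ * Θ (f x) := by
      rw [inv_mul_eq_div, le_div_iff₀ hL0, mul_comm]; exact this
    simpa only [ENNReal.coe_mul] using ENNReal.coe_le_coe.2 h3
  -- The truncation at `1` is what allows a `p`-th power to be bounded linearly.
  have h3 : min 1 b ^ p ≤ b := by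
    refine (pow_le_pow_right_of_le_one' (min_le_left _ _) (show 1 ≤ p by omega)).trans ?_
    rw [pow_one]
    exact min_le_right _ _
  have h4 : 2 ^ p * (h * C + L⁻¹) ≤ η := by
    have h5 : h * C ≤ η / 2 ^ (p + 1) := by
      calc h * C ≤ η / (2 ^ (p + 1) * (C + 1)) * (C + 1) := by
            gcongr
            · exact min_le_right _ _
            · exact le_self_add
        _ = η / 2 ^ (p + 1) := by field_simp
    calc 2 ^ p * (h * C + L⁻¹) ≤ 2 ^ p * (η / 2 ^ (p + 1) + η / 2 ^ (p + 1)) := by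
          rw [hL, inv_div]; gcongr
      _ = η := by rw [pow_succ]; field_simp; norm_num
  calc min 1 (∫⁻ x, f x ∂μ) ^ p ≤ (a + min 1 b) ^ p := by
        rw [hab]
        gcongr
        rw [add_comm a (min 1 b), min_add, add_comm b a]
        exact min_le_min le_self_add le_rfl
    _ ≤ 2 ^ p * (a ^ p + min 1 b ^ p) := ENNReal.add_pow_le_two_pow_mul _ _ _
    _ ≤ 2 ^ p * ((h * C : ℝ≥0) * T + (L⁻¹ : ℝ≥0) * T) := by gcongr; exact h3.trans h2
    _ = (2 ^ p * (h * C + L⁻¹) : ℝ≥0) * T := by push_cast; ring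
    _ ≤ η * T := by gcongr

/-- On sets of small measure, `∫ f` can only be large if `∫ Θ ∘ f` is very large. -/
lemma exists_one_le_mul_lintegral (hm : Measurable Θ)
    (hΘ : Tendsto (fun x => Θ x / x) atTop atTop) {ε η : ℝ≥0} (hε : 0 < ε) (hη : 0 < η) :
    ∃ h : ℝ≥0, 0 < h ∧ ∀ {α : Type*} [MeasurableSpace α] (μ : Measure α) (f : α → ℝ≥0),
      Measurable f → μ Set.univ ≤ h → (ε : ℝ≥0∞) ≤ ∫⁻ x, f x ∂μ →
        1 ≤ η * ∫⁻ x, Θ (f x) ∂μ := by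
  set L : ℝ≥0 := 2 / (ε * η) with hL
  have hL0 : 0 < L := by positivity
  obtain ⟨R, hR0, hR⟩ := exists_mul_le_of_tendsto_div hΘ L
  -- From `f ≤ Θ(f) / L + R`, the constant contributes at most `ε / 2`, so `Θ(f) / L` must supply
  -- the other half.
  refine ⟨ε / 2 / R, by positivity, ?_⟩
  intro α _ μ f hf hμ hε'
  set T := ∫⁻ x, (Θ (f x) : ℝ≥0∞) ∂μ with hT
  have h1 : ∫⁻ x, f x ∂μ ≤ (L⁻¹ : ℝ≥0) * T + (ε / 2 : ℝ≥0) := by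
    calc ∫⁻ x, f x ∂μ ≤ ∫⁻ x, ((L⁻¹ : ℝ≥0) * Θ (f x) + (R : ℝ≥0∞)) ∂μ := by
          refine lintegral_mono fun x => ?_
          have h3 : f x ≤ L⁻¹ * Θ (f x) + R := by
            rcases le_total R (f x) with hx | hx
            · refine le_trans ?_ le_self_add
              rw [inv_mul_eq_div, le_div_iff₀ hL0, mul_comm]; exact hR _ hx
            · exact hx.trans le_add_self
          simpa only [ENNReal.coe_add, ENNReal.coe_mul] using ENNReal.coe_le_coe.2 h3
      _ = (L⁻¹ : ℝ≥0) * T + R * μ Set.univ := by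
          rw [lintegral_add_right _ measurable_const, lintegral_const_mul _ (by fun_prop),
            lintegral_const]
      _ ≤ (L⁻¹ : ℝ≥0) * T + R * (ε / 2 / R : ℝ≥0) := by gcongr
      _ = _ := by
          rw [← ENNReal.coe_mul, mul_div_cancel₀ _ hR0.ne']
  have h2 : ((ε / 2 : ℝ≥0) : ℝ≥0∞) ≤ (L⁻¹ : ℝ≥0) * T := by
    have h3 : ((ε / 2 : ℝ≥0) : ℝ≥0∞) + (ε / 2 : ℝ≥0) ≤ (L⁻¹ : ℝ≥0) * T + (ε / 2 : ℝ≥0) := by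
      rw [← ENNReal.coe_add, add_halves]
      exact hε'.trans h1
    exact (ENNReal.add_le_add_iff_right ENNReal.coe_ne_top).1 h3
  calc (1 : ℝ≥0∞) = (2 / ε : ℝ≥0) * (ε / 2 : ℝ≥0) := by
        rw [← ENNReal.coe_mul, div_mul_div_cancel₀ hε.ne', div_self two_ne_zero, ENNReal.coe_one]
    _ ≤ (2 / ε : ℝ≥0) * ((L⁻¹ : ℝ≥0) * T) := by gcongr
    _ = η * T := by
        rw [← mul_assoc, ← ENNReal.coe_mul, hL, inv_div]
        congr 2
        field_simp

end Growth

/-! ### Oscillation of the process on a fine grid -/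

/-! ### Pathwise time integrals -/

section TimeIntegral

variable {Ω : Type*} {mΩ : MeasurableSpace Ω} {𝓕 : Filtration I mΩ} {β : I → Ω → ℝ} {ω : Ω}

lemma MeasureTheory.IsStronglyProgressive.measurable_uncurry (h : IsStronglyProgressive 𝓕 β) :
    Measurable (Function.uncurry β) := by
  have h1 : Measurable fun p : Set.Iic (1 : I) × Ω => β p.1 p.2 :=
    ((h 1).mono (sup_le_sup le_rfl (MeasurableSpace.comap_mono (𝓕.le 1)))).measurable
  have h2 : Measurable fun p : I × Ω => ((⟨p.1, unitInterval.le_one'⟩ : Set.Iic (1 : I)), p.2) :=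
    (measurable_fst.subtype_mk).prodMk measurable_snd
  exact h1.comp h2

/-- Progressive measurability gives joint measurability on `[0, t] × Ω` for the σ-algebra at time
`t`, so integrating out time preserves adaptedness. -/
lemma MeasureTheory.IsStronglyProgressive.stronglyAdapted_timeIntegral
    (h : IsStronglyProgressive 𝓕 β) : StronglyAdapted 𝓕 (timeIntegral β) := by
  intro t
  have h1 : timeIntegral β t =
      fun ω => ∫ s : Set.Iic t, β s ω ∂(volume.comap Subtype.val) := by
    funext ω
    exact (integral_subtype_comap measurableSet_Iic fun s => β s ω).symm
  rw [h1]
  exact @StronglyMeasurable.integral_prod_left' _ _ _ _ (𝓕 t) _ _ _ _ _ (h t)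

lemma timeIntegral_sub_timeIntegral (h : Integrable fun t => β t ω) {s t : I} (hst : s ≤ t) :
    timeIntegral β t ω - timeIntegral β s ω = ∫ u in Set.Ioc s t, β u ω := by
  rw [timeIntegral, timeIntegral, ← Set.Iic_union_Ioc_eq_Iic hst,
    setIntegral_union (Set.Iic_disjoint_Ioc le_rfl) measurableSet_Ioc h.integrableOn h.integrableOn,
    add_sub_cancel_left]

lemma monotone_timeIntegral (h : Integrable fun t => β t ω) (h0 : ∀ᵐ t, 0 ≤ β t ω) :
    Monotone fun t => timeIntegral β t ω := by
  intro s t hst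
  have h1 := timeIntegral_sub_timeIntegral h hst
  have h2 : 0 ≤ ∫ u in Set.Ioc s t, β u ω := integral_nonneg_of_ae (ae_restrict_of_ae h0)
  simp only
  linarith

lemma ofReal_timeIntegral_sub (h : Integrable fun t => β t ω) (h0 : ∀ᵐ t, 0 ≤ β t ω) {s t : I}
    (hst : s ≤ t) : ENNReal.ofReal (timeIntegral β t ω - timeIntegral β s ω) =
      ∫⁻ u in Set.Ioc s t, ((β u ω).toNNReal : ℝ≥0∞) := by
  rw [timeIntegral_sub_timeIntegral h hst,
    ofReal_integral_eq_lintegral_ofReal h.integrableOn (ae_restrict_of_ae h0)]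
  rfl

lemma enorm_timeIntegral_sub_le (h : Integrable fun t => β t ω) {s u t : I}
    (hsu : s ≤ u) (hut : u ≤ t) : ‖timeIntegral β u ω - timeIntegral β s ω‖ₑ ≤
      ∫⁻ u in Set.Ioc s t, (‖β u ω‖₊ : ℝ≥0∞) := by
  rw [timeIntegral_sub_timeIntegral h hsu]
  refine (enorm_integral_le_lintegral_enorm _).trans ?_
  exact lintegral_mono_set (Set.Ioc_subset_Ioc_right hut)

lemma continuous_timeIntegral (h : Integrable fun t => β t ω) :
    Continuous fun t => timeIntegral β t ω := by
  have h1 : ∀ t, timeIntegral β t ω = ∫ s, (Set.Iic t).indicator (fun s => β s ω) s := fun t =>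
    (integral_indicator measurableSet_Iic).symm
  simp only [h1]
  refine continuous_iff_continuousAt.2 fun t => continuousAt_of_dominated
    (Eventually.of_forall fun u => (h.indicator measurableSet_Iic).1)
    (Eventually.of_forall fun u => ae_of_all _ fun s => norm_indicator_le_norm_self _ _) h.norm ?_
  filter_upwards [Measure.ae_ne (volume : Measure I) t] with s hs
  rcases lt_or_gt_of_ne hs with hs | hs
  · refine (continuousAt_const (y := β s ω)).congr ?_
    filter_upwards [lt_mem_nhds hs] with u hu
    exact (Set.indicator_of_mem (Set.mem_Iic.2 hu.le) (fun s => β s ω)).symm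
  · refine (continuousAt_const (y := (0 : ℝ))).congr ?_
    filter_upwards [gt_mem_nhds hs] with u hu
    exact (Set.indicator_of_notMem (by simpa using hu) (fun s => β s ω)).symm

end TimeIntegral

/-- The point `k / n` of the unit interval. -/
noncomputable def gridPoint (n k : ℕ) : I := Set.projIcc 0 1 zero_le_one ((k : ℝ) / n)

lemma gridPoint_mono (n : ℕ) : Monotone (gridPoint n) := fun j k hjk =>
  Set.monotone_projIcc _ (by gcongr)

lemma coe_gridPoint {n k : ℕ} (hk : k ≤ n) : (gridPoint n k : ℝ) = k / n := by
  rw [gridPoint, Set.projIcc_of_mem]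
  exact ⟨by positivity, div_le_one_of_le₀ (by exact_mod_cast hk) (by positivity)⟩

lemma gridPoint_succ_sub {n k : ℕ} (hk : k < n) :
    (gridPoint n (k + 1) : ℝ) - gridPoint n k = 1 / n := by
  rw [coe_gridPoint hk, coe_gridPoint hk.le]
  push_cast
  ring

lemma gridPoint_lt_succ {n k : ℕ} (hk : k < n) : gridPoint n k < gridPoint n (k + 1) := by
  have h1 := gridPoint_succ_sub hk
  have h2 : (0 : ℝ) < 1 / n := by
    have : 0 < n := by omega
    positivity
  exact Subtype.coe_lt_coe.1 (by linarith)

lemma sum_setLIntegral_gridPoint_le (n : ℕ) (f : I → ℝ≥0∞) :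
    ∑ k ∈ Finset.range n, ∫⁻ t in Set.Ioc (gridPoint n k) (gridPoint n (k + 1)), f t ≤
      ∫⁻ t, f t := by
  rw [← lintegral_biUnion_finset _ fun k _ => measurableSet_Ioc]
  · exact setLIntegral_le_lintegral _ _
  · exact ((gridPoint_mono n).pairwise_disjoint_on_Ioc_succ).set_pairwise _

/-- On a fine enough grid, the probability that the process oscillates by more than `ε` on some
cell is a small multiple of the cost. -/
theorem exists_measure_iUnion_exceedEvent_le {Θ₁ Θ₂ : ℝ≥0 → ℝ≥0}
    (hm₁ : Measurable Θ₁) (hm₂ : Measurable Θ₂)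
    (hΘ₁ : Tendsto (fun x => Θ₁ x / x) atTop atTop)
    (hΘ₂ : Tendsto (fun x => Θ₂ x / x) atTop atTop)
    (hd : ∃ C : ℝ≥0, ∀ x, Θ₂ (2 * x) ≤ C * Θ₂ x) {ε η : ℝ≥0} (hε : 0 < ε) (hη : 0 < η) :
    ∃ n : ℕ, 0 < n ∧ ∀ {Ω : Type*} {mΩ : MeasurableSpace Ω} {P : Measure Ω}
      [IsProbabilityMeasure P] {𝓕 : Filtration I mΩ} {φ β α : I → Ω → ℝ} {Q : Set I},
      IsStronglyProgressive 𝓕 φ → IsStronglyProgressive 𝓕 β → IsStronglyProgressive 𝓕 α →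
      (∀ᵐ ω ∂P, Integrable fun t => β t ω) → (∀ᵐ ω ∂P, Integrable fun t => α t ω) →
      (∀ᵐ ω ∂P, ∀ᵐ t, 0 ≤ α t ω) →
      IsContinuousLocalMartingale P 𝓕 (fun t ω => φ t ω - timeIntegral β t ω) →
      IsContinuousLocalMartingale P 𝓕
        (fun t ω => (φ t ω - timeIntegral β t ω) ^ 2 - timeIntegral α t ω) →
      Dense Q → Q.Countable →
      P (⋃ k ∈ Finset.range n, exceedEvent φ Q (gridPoint n k) (gridPoint n (k + 1)) ε) ≤
        η * ∫⁻ ω, (∫⁻ t, ((Θ₁ ‖β t ω‖₊ : ℝ≥0∞) + (Θ₂ (α t ω).toNNReal : ℝ≥0∞))) ∂P := by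
  obtain ⟨p, hp, hpow⟩ := exists_pow_le_mul hΘ₂ hd
  obtain ⟨C, hC⟩ := exists_measure_exceedEvent_le p (ε := (ε : ℝ) / 2) (by positivity)
  obtain ⟨h₁, hh₁, H₁⟩ := exists_one_le_mul_lintegral hm₁ hΘ₁ (half_pos hε) hη
  -- The factor `1 / (C + 1)` absorbs the constant of the tail bound.
  obtain ⟨h₂, hh₂, H₂⟩ := exists_min_one_pow_lintegral_le hm₂ hΘ₂ hp hpow
    (η := η / (C + 1)) (by positivity)
  obtain ⟨n, hn⟩ := exists_nat_gt ((min h₁ h₂)⁻¹)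
  have hn0 : (0 : ℝ≥0) < n := zero_le.trans_lt hn
  have hn1 : (1 / n : ℝ≥0) ≤ min h₁ h₂ := by
    rw [one_div]; exact inv_le_of_inv_le₀ (lt_min hh₁ hh₂) hn.le
  refine ⟨n, by exact_mod_cast hn0, ?_⟩
  intro Ω mΩ P _ 𝓕 φ β α Q hφ hβ hα hβi hαi hα0 hM hMA hQ hQc
  set G₁ : Ω → I → ℝ≥0∞ := fun ω t => Θ₁ ‖β t ω‖₊ with hG₁
  set G₂ : Ω → I → ℝ≥0∞ := fun ω t => Θ₂ (α t ω).toNNReal with hG₂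
  have hβm := hβ.measurable_uncurry
  have hαm := hα.measurable_uncurry
  have hG₁m : Measurable (Function.uncurry G₁) :=
    (hm₁.comp (hβm.comp measurable_swap).nnnorm).coe_nnreal_ennreal
  have hG₂m : Measurable (Function.uncurry G₂) :=
    (hm₂.comp (hαm.comp measurable_swap).real_toNNReal).coe_nnreal_ennreal
  have hI₁ : ∀ s t, Measurable fun ω => ∫⁻ u in Set.Ioc s t, G₁ ω u := fun s t =>
    hG₁m.lintegral_prod_right'
  have hI₂ : ∀ s t, Measurable fun ω => ∫⁻ u in Set.Ioc s t, G₂ ω u := fun s t =>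
    hG₂m.lintegral_prod_right'
  have hMad : StronglyAdapted 𝓕 fun t ω => φ t ω - timeIntegral β t ω := fun t =>
    (hφ.stronglyAdapted t).sub (hβ.stronglyAdapted_timeIntegral t)
  have hcell : ∀ k ∈ Finset.range n,
      P (exceedEvent φ Q (gridPoint n k) (gridPoint n (k + 1)) ε) ≤
        η * ∫⁻ ω, (∫⁻ t in Set.Ioc (gridPoint n k) (gridPoint n (k + 1)), (G₁ ω t + G₂ ω t)) ∂P := by
    intro k hk
    have hkn := Finset.mem_range.1 hk
    set s := gridPoint n k with hs
    set t := gridPoint n (k + 1) with ht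
    have hst : s < t := gridPoint_lt_succ hkn
    have hvol : (volume.restrict (Set.Ioc s t)) Set.univ ≤ ((min h₁ h₂ : ℝ≥0) : ℝ≥0∞) := by
      rw [Measure.restrict_apply_univ, unitInterval.volume_Ioc, gridPoint_succ_sub hkn]
      refine (ENNReal.coe_le_coe.2 hn1).trans' (le_of_eq ?_)
      rw [← ENNReal.ofReal_coe_nnreal]
      simp
    -- On this event `η * ∫ Θ₁(|β|)` over the cell is at least `1`, so Markov's inequality at level
    -- `1` suffices.
    have hdrift : P (exceedEvent (timeIntegral β) Q s t ((ε : ℝ) / 2)) ≤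
        η * ∫⁻ ω, (∫⁻ u in Set.Ioc s t, G₁ ω u) ∂P := by
      rw [← lintegral_const_mul _ (hI₁ s t)]
      have hmk := mul_meas_ge_le_lintegral₀ (μ := P) ((hI₁ s t).const_mul (η : ℝ≥0∞)).aemeasurable 1
      rw [one_mul] at hmk
      refine (measure_mono_ae ?_).trans hmk
      filter_upwards [hβi] with ω hω
      rintro ⟨u, -, hu, hul⟩
      refine H₁ (volume.restrict (Set.Ioc s t)) (fun u => ‖β u ω‖₊)
        (hβm.comp measurable_prodMk_right).nnnorm
        (hvol.trans (ENNReal.coe_le_coe.2 (min_le_left _ _))) ?_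
      refine le_trans ?_ (enorm_timeIntegral_sub_le hω hu.1.le hu.2.le)
      rw [Real.enorm_eq_ofReal_abs, ← ENNReal.ofReal_coe_nnreal]
      refine ENNReal.ofReal_le_ofReal (le_trans (le_of_eq ?_) hul.le)
      push_cast
      rfl
    have hmart : P (exceedEvent (fun t ω => φ t ω - timeIntegral β t ω) Q s t ((ε : ℝ) / 2)) ≤
        η * ∫⁻ ω, (∫⁻ u in Set.Ioc s t, G₂ ω u) ∂P := by
      have hmono : ∀ᵐ ω ∂P, Monotone fun u => timeIntegral α u ω := by
        filter_upwards [hαi, hα0] with ω h1 h2 using monotone_timeIntegral h1 h2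
      refine (hC hMad hα.stronglyAdapted_timeIntegral hmono hM hMA hQ hQc hst).trans ?_
      have h3 : ∫⁻ ω, min 1 (ENNReal.ofReal (timeIntegral α t ω - timeIntegral α s ω)) ^ p ∂P ≤
          (η / (C + 1) : ℝ≥0) * ∫⁻ ω, (∫⁻ u in Set.Ioc s t, G₂ ω u) ∂P := by
        rw [← lintegral_const_mul _ (hI₂ s t)]
        refine lintegral_mono_ae ?_
        filter_upwards [hαi, hα0] with ω h1 h2
        rw [ofReal_timeIntegral_sub h1 h2 hst.le]
        exact H₂ (volume.restrict (Set.Ioc s t)) (fun u => (α u ω).toNNReal)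
          (hαm.comp measurable_prodMk_right).real_toNNReal
          (hvol.trans (ENNReal.coe_le_coe.2 (min_le_right _ _)))
      calc _ ≤ (C : ℝ≥0∞) * ((η / (C + 1) : ℝ≥0) * ∫⁻ ω, (∫⁻ u in Set.Ioc s t, G₂ ω u) ∂P) := by
            gcongr
        _ = (C * (η / (C + 1)) : ℝ≥0) * ∫⁻ ω, (∫⁻ u in Set.Ioc s t, G₂ ω u) ∂P := by
            rw [← mul_assoc, ENNReal.coe_mul]
        _ ≤ _ := by
            gcongr
            calc C * (η / (C + 1)) ≤ (C + 1) * (η / (C + 1)) := by gcongr; exact le_self_add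
              _ = η := mul_div_cancel₀ _ (by positivity)
    calc P (exceedEvent φ Q s t ε)
        ≤ P (exceedEvent (timeIntegral β) Q s t ((ε : ℝ) / 2) ∪
            exceedEvent (fun t ω => φ t ω - timeIntegral β t ω) Q s t ((ε : ℝ) / 2)) := by
          refine measure_mono fun ω ⟨u, huQ, hu, hul⟩ => ?_
          by_contra hcon
          simp only [Set.mem_union, not_or, exceedEvent, Set.mem_ofPred_eq, not_exists, not_and,
            not_lt] at hcon
          have h1 := hcon.1 u huQ hu
          have h2 := hcon.2 u huQ hu
          have h3 := abs_add_le (timeIntegral β u ω - timeIntegral β s ω)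
            (φ u ω - timeIntegral β u ω - (φ s ω - timeIntegral β s ω))
          have h4 : timeIntegral β u ω - timeIntegral β s ω +
            (φ u ω - timeIntegral β u ω - (φ s ω - timeIntegral β s ω)) = φ u ω - φ s ω := by ring
          rw [h4] at h3
          linarith
      _ ≤ _ := measure_union_le _ _
      _ ≤ _ := add_le_add hdrift hmart
      _ = η * ∫⁻ ω, (∫⁻ u in Set.Ioc s t, (G₁ ω u + G₂ ω u)) ∂P := by
          rw [← mul_add, ← lintegral_add_left (hI₁ s t)]
          congr 1
          refine lintegral_congr fun ω => ?_
          exact (lintegral_add_left (hG₁m.comp measurable_prodMk_left) _).symm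
  have hI : ∀ s t, Measurable fun ω => ∫⁻ u in Set.Ioc s t, (G₁ ω u + G₂ ω u) := fun s t =>
    (hG₁m.add hG₂m).lintegral_prod_right'
  calc _ ≤ ∑ k ∈ Finset.range n, P (exceedEvent φ Q (gridPoint n k) (gridPoint n (k + 1)) ε) :=
        measure_biUnion_finset_le _ _
    _ ≤ ∑ k ∈ Finset.range n, η * ∫⁻ ω,
          (∫⁻ t in Set.Ioc (gridPoint n k) (gridPoint n (k + 1)), (G₁ ω t + G₂ ω t)) ∂P :=
        Finset.sum_le_sum hcell
    _ = η * ∫⁻ ω, (∑ k ∈ Finset.range n,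
          ∫⁻ t in Set.Ioc (gridPoint n k) (gridPoint n (k + 1)), (G₁ ω t + G₂ ω t)) ∂P := by
        rw [← Finset.mul_sum, lintegral_finsetSum _ fun k _ => hI _ _]
    _ ≤ _ := by
        gcongr with ω
        exact sum_setLIntegral_gridPoint_le n _

/-! ### The coercive functional -/

lemma exists_mem_gridPoint_cell {n : ℕ} (hn : 0 < n) (x : I) :
    ∃ k < n, x ∈ Set.Icc (gridPoint n k) (gridPoint n (k + 1)) := by
  have h0 : gridPoint n 0 = 0 := Subtype.ext (by rw [coe_gridPoint (Nat.zero_le n)]; simp)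
  have h1 : gridPoint n n = 1 := Subtype.ext (by
    rw [coe_gridPoint le_rfl, div_self (by positivity)]; simp)
  have key : ∀ m, x ≤ gridPoint n (m + 1) →
      ∃ k ≤ m, x ∈ Set.Icc (gridPoint n k) (gridPoint n (k + 1)) := by
    intro m
    induction m with
    | zero => exact fun h => ⟨0, le_rfl, h0 ▸ unitInterval.nonneg', h⟩
    | succ m ih =>
      intro h
      rcases le_total x (gridPoint n (m + 1)) with h' | h'
      · obtain ⟨k, hk, hx⟩ := ih h'
        exact ⟨k, hk.trans m.le_succ, hx⟩
      · exact ⟨m + 1, le_rfl, h', h⟩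
  obtain ⟨m, rfl⟩ := Nat.exists_eq_add_of_le' hn
  obtain ⟨k, hk, hx⟩ := key m (h1 ▸ unitInterval.le_one')
  exact ⟨k, by omega, hx⟩

/-- The paths oscillating by more than `ε` on some cell of the grid of mesh `1 / n`. -/
def oscSet (n : ℕ) (ε : ℝ) : Set C(I, ℝ) :=
  {f | ∃ k < n, ∃ u ∈ Set.Icc (gridPoint n k) (gridPoint n (k + 1)), ε < |f u - f (gridPoint n k)|}

lemma isOpen_oscSet (n : ℕ) (ε : ℝ) : IsOpen (oscSet n ε) := by
  have : oscSet n ε = ⋃ k ∈ Set.Iio n, ⋃ u ∈ Set.Icc (gridPoint n k) (gridPoint n (k + 1)),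
      {f : C(I, ℝ) | ε < |f u - f (gridPoint n k)|} := by
    ext f; simp only [oscSet, Set.mem_ofPred_eq, Set.mem_iUnion, Set.mem_Iio, exists_prop]
  rw [this]
  refine isOpen_biUnion fun k _ => isOpen_biUnion fun u _ => ?_
  exact isOpen_lt continuous_const
    ((continuous_eval_const u).sub (continuous_eval_const _)).abs

lemma abs_sub_le_of_notMem_oscSet {n : ℕ} {ε : ℝ} {f : C(I, ℝ)} (hf : f ∉ oscSet n ε) {k : ℕ}
    (hk : k < n) {u : I} (hu : u ∈ Set.Icc (gridPoint n k) (gridPoint n (k + 1))) :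
    |f u - f (gridPoint n k)| ≤ ε :=
  le_of_not_gt fun h => hf ⟨k, hk, u, hu, h⟩

lemma abs_le_of_notMem_oscSet {n : ℕ} (hn : 0 < n) {ε : ℝ} {f : C(I, ℝ)} (hf : f ∉ oscSet n ε)
    (x : I) : |f x| ≤ |f 0| + n * ε := by
  have h0 : gridPoint n 0 = 0 := Subtype.ext (by rw [coe_gridPoint (Nat.zero_le n)]; simp)
  have hε : 0 ≤ ε := (abs_nonneg _).trans
    (abs_sub_le_of_notMem_oscSet hf hn ⟨le_rfl, gridPoint_mono n (Nat.le_succ 0)⟩)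
  have hstep : ∀ k < n, ∀ u ∈ Set.Icc (gridPoint n k) (gridPoint n (k + 1)),
      |f u| ≤ |f (gridPoint n k)| + ε := fun k hk u hu => by
    have h1 := abs_sub_le_of_notMem_oscSet hf hk hu
    have h2 := abs_sub_abs_le_abs_sub (f u) (f (gridPoint n k))
    linarith
  have hgrid : ∀ k ≤ n, |f (gridPoint n k)| ≤ |f 0| + k * ε := by
    intro k
    induction k with
    | zero => simp [h0]
    | succ k ih =>
      intro hk
      have h1 := ih (by omega)
      have h2 := hstep k hk _ ⟨gridPoint_mono n k.le_succ, le_rfl⟩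
      push_cast
      linarith
  obtain ⟨k, hk, hx⟩ := exists_mem_gridPoint_cell hn x
  have h1 := hstep k hk x hx
  have h2 := hgrid k hk.le
  have h3 : ((k : ℝ) + 1) * ε ≤ n * ε := by
    gcongr
    exact_mod_cast hk
  linarith

/-- Points closer than the mesh lie in the same cell or in adjacent ones, so at most three
comparisons with left endpoints are needed. -/
lemma abs_sub_le_three_mul_of_notMem_oscSet {n : ℕ} (hn : 0 < n) {ε : ℝ} {f : C(I, ℝ)}
    (hf : f ∉ oscSet n ε) {x y : I} (hxy : dist x y < 1 / n) : |f x - f y| ≤ 3 * ε := by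
  obtain ⟨k, hk, hx⟩ := exists_mem_gridPoint_cell hn x
  obtain ⟨l, hl, hy⟩ := exists_mem_gridPoint_cell hn y
  wlog hkl : k ≤ l generalizing x y k l
  · rw [abs_sub_comm]
    exact this (by rwa [dist_comm]) l hl hy k hk hx (le_of_not_ge hkl)
  have hfx := abs_le.1 (abs_sub_le_of_notMem_oscSet hf hk hx)
  have hfy := abs_le.1 (abs_sub_le_of_notMem_oscSet hf hl hy)
  have hfk := abs_le.1 (abs_sub_le_of_notMem_oscSet hf hk
    (u := gridPoint n (k + 1)) ⟨gridPoint_mono n k.le_succ, le_rfl⟩)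
  rcases hkl.eq_or_lt with rfl | hlt
  · rw [abs_le]
    constructor <;> linarith
  rcases (Nat.succ_le_of_lt hlt).eq_or_lt with rfl | hlt'
  · rw [Nat.succ_eq_add_one] at *
    rw [abs_le]
    constructor <;> linarith
  · exfalso
    have h1 : (gridPoint n (k + 2) : ℝ) ≤ y := (gridPoint_mono n hlt').trans hy.1
    have h2 : (x : ℝ) ≤ gridPoint n (k + 1) := hx.2
    have h3 := gridPoint_succ_sub (n := n) (k := k + 1) (by omega)
    rw [Subtype.dist_eq, Real.dist_eq] at hxy
    have := neg_abs_le ((x : ℝ) - y)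
    rw [show k + 1 + 1 = k + 2 from rfl] at h3
    linarith

/-- Passes from an uncountable condition on closed cells to a measurable event over countably many
times when `Q` is countable. -/
lemma mem_iUnion_exceedEvent_of_mem_oscSet {Ω : Type*} {φ : I → Ω → ℝ} {ω : Ω}
    (hc : Continuous fun t => φ t ω) {Q : Set I} (hQ : Dense Q) {n : ℕ} {ε : ℝ}
    (h : (⟨fun t => φ t ω, hc⟩ : C(I, ℝ)) ∈ oscSet n ε) :
    ω ∈ ⋃ k ∈ Finset.range n, exceedEvent φ Q (gridPoint n k) (gridPoint n (k + 1)) ε := by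
  obtain ⟨k, hk, u, hu, hul⟩ := h
  simp only [Set.mem_iUnion, Finset.mem_range]
  refine ⟨k, hk, ?_⟩
  by_contra hcon
  simp only [exceedEvent, Set.mem_ofPred_eq, not_exists, not_and, not_lt] at hcon
  exact hul.not_ge ((hc.sub continuous_const).abs.forall_le_of_forall_dense hQ
    (gridPoint_lt_succ hk) hcon u hu)

/-- The functional penalizing large initial values and large oscillations. -/
noncomputable def oscFunctional (r : ℕ → ℝ) (n : ℕ → ℕ) (ε : ℕ → ℝ) (f : C(I, ℝ)) : ℝ≥0∞ :=
  (⨆ i : ℕ, {f : C(I, ℝ) | r i < |f 0|}.indicator (fun _ => (i : ℝ≥0∞)) f) +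
    ∑' j : ℕ, (oscSet (n j) (ε j)).indicator (fun _ => (j : ℝ≥0∞)) f

lemma lowerSemicontinuous_oscFunctional (r : ℕ → ℝ) (n : ℕ → ℕ) (ε : ℕ → ℝ) :
    LowerSemicontinuous (oscFunctional r n ε) := by
  refine LowerSemicontinuous.add (lowerSemicontinuous_iSup fun i => ?_)
    (lowerSemicontinuous_tsum fun j => ?_)
  · refine IsOpen.lowerSemicontinuous_indicator ?_ zero_le
    exact isOpen_lt continuous_const (continuous_eval_const (0 : I)).abs
  · exact (isOpen_oscSet _ _).lowerSemicontinuous_indicator zero_le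

/-- Lower semicontinuity makes sublevel sets closed. At level `c < N`, the penalty `N` bounds the
initial value and every oscillation penalty with `j ≥ N` is excluded; the grid `n N` then gives a
uniform bound and the later grids give equicontinuity. -/
theorem isCoerciveFunctional_oscFunctional (r : ℕ → ℝ) {n : ℕ → ℕ} (hn : ∀ j, 0 < n j) {ε : ℕ → ℝ}
    (hε : Tendsto ε atTop (𝓝 0)) : IsCoerciveFunctional (oscFunctional r n ε) := by
  intro c
  set S := {f | oscFunctional r n ε f ≤ c} with hS
  have hcl : IsClosed S := (lowerSemicontinuous_oscFunctional r n ε).isClosed_preimage c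
  obtain ⟨N, hN⟩ := exists_nat_gt c
  have hr : ∀ f ∈ S, |f 0| ≤ r N := by
    intro f hf
    by_contra! h
    have h1 : (N : ℝ≥0∞) ≤ oscFunctional r n ε f := by
      refine le_trans (le_trans (le_of_eq ?_) (le_iSup (fun i : ℕ =>
        {f : C(I, ℝ) | r i < |f 0|}.indicator (fun _ => (i : ℝ≥0∞)) f) N)) le_self_add
      exact (Set.indicator_of_mem (s := {f : C(I, ℝ) | r N < |f 0|}) h
        (fun _ => (N : ℝ≥0∞))).symm
    exact (h1.trans hf).not_gt (by exact_mod_cast hN)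
  have hosc : ∀ f ∈ S, ∀ j ≥ N, f ∉ oscSet (n j) (ε j) := by
    intro f hf j hj h
    have h1 : (j : ℝ≥0∞) ≤ oscFunctional r n ε f := by
      refine le_trans (le_trans (le_of_eq ?_) (ENNReal.le_tsum j)) le_add_self
      exact (Set.indicator_of_mem h (fun _ => (j : ℝ≥0∞))).symm
    refine (h1.trans hf).not_gt ?_
    have : (N : ℝ≥0∞) ≤ j := by exact_mod_cast hj
    exact lt_of_lt_of_le (by exact_mod_cast hN) this
  set e := ContinuousMap.isometryEquivBoundedOfCompact I ℝ with he
  have hcomp : IsCompact (e.symm ⁻¹' S) := by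
    refine BoundedContinuousFunction.arzela_ascoli₂ (Set.Icc (-(r N + n N * ε N)) (r N + n N * ε N))
      isCompact_Icc _ (hcl.preimage e.symm.continuous) (fun f x hf => ?_) ?_
    · have h1 := abs_le_of_notMem_oscSet (hn N) (hosc _ hf N le_rfl) x
      have h2 := hr _ hf
      exact abs_le.1 (h1.trans (by linarith))
    · refine fun x => Metric.equicontinuousAt_iff.2 fun ε₀ hε₀ => ?_
      have h3 : ∀ᶠ j in atTop, ε j < ε₀ / 3 := hε.eventually (gt_mem_nhds (by positivity))
      obtain ⟨j, hj, hjN⟩ := (h3.and (eventually_ge_atTop N)).exists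
      refine ⟨1 / n j, by have := hn j; positivity, fun y hy f => ?_⟩
      have h4 := abs_sub_le_three_mul_of_notMem_oscSet (hn j) (hosc _ f.2 j hjN)
        (x := x) (y := y) (by rwa [dist_comm])
      rw [Real.dist_eq]
      exact h4.trans_lt (by linarith)
  have := hcomp.image e.symm.continuous
  rwa [Set.image_preimage_eq _ e.symm.surjective] at this

/-- The expectation of the functional along a process is at most that of the sum of the
penalization of the initial value and a bound on the oscillation penalization. -/
lemma lintegral_pathValue_oscFunctional_le {Ω : Type*} {mΩ : MeasurableSpace Ω} {P : Measure Ω}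
    {φ : I → Ω → ℝ} (hφm : ∀ t, Measurable (φ t)) (hc : ∀ᵐ ω ∂P, Continuous fun t => φ t ω)
    {Q : Set I} (hQ : Dense Q) (hQc : Q.Countable) (r : ℕ → ℝ) (n : ℕ → ℕ) (ε : ℕ → ℝ) :
    ∫⁻ ω, pathValue (oscFunctional r n ε) (fun t => φ t ω) ∂P ≤
      ∫⁻ ω, (⨆ i : ℕ, {ω | r i < |φ 0 ω|}.indicator (fun _ => (i : ℝ≥0∞)) ω) ∂P +
        ∑' j : ℕ, j * P (⋃ k ∈ Finset.range (n j),
          exceedEvent φ Q (gridPoint (n j) k) (gridPoint (n j) (k + 1)) (ε j)) := by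
  have hEm : ∀ j, MeasurableSet (⋃ k ∈ Finset.range (n j),
      exceedEvent φ Q (gridPoint (n j) k) (gridPoint (n j) (k + 1)) (ε j)) := fun j =>
    Finset.measurableSet_biUnion _ fun k _ => measurableSet_exceedEvent hφm hQc _ _ _
  have hsum : ∑' j : ℕ, j * P (⋃ k ∈ Finset.range (n j),
      exceedEvent φ Q (gridPoint (n j) k) (gridPoint (n j) (k + 1)) (ε j)) =
      ∫⁻ ω, ∑' j : ℕ, (⋃ k ∈ Finset.range (n j), exceedEvent φ Q (gridPoint (n j) k)
        (gridPoint (n j) (k + 1)) (ε j)).indicator (fun _ => (j : ℝ≥0∞)) ω ∂P := by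
    rw [lintegral_tsum fun j => (measurable_const.indicator (hEm j)).aemeasurable]
    exact tsum_congr fun j => (lintegral_indicator_const (hEm j) _).symm
  rw [hsum, ← lintegral_add_right _
    (Measurable.tsum fun j => measurable_const.indicator (hEm j))]
  refine lintegral_mono_ae ?_
  filter_upwards [hc] with ω hω
  rw [pathValue, dif_pos hω, oscFunctional]
  refine add_le_add le_rfl (ENNReal.tsum_le_tsum fun j => ?_)
  refine Set.indicator_apply_le' (fun h => ?_) fun _ => zero_le
  rw [Set.indicator_of_mem (mem_iUnion_exceedEvent_of_mem_oscSet hω hQ h)]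

theorem theoremA2
    (θ Θ₁ Θ₂ : ℝ≥0 → ℝ≥0)
    (hΘ₁_convex : ConvexOn ℝ≥0 Set.univ Θ₁) (hΘ₂_convex : ConvexOn ℝ≥0 Set.univ Θ₂)
    (hΘ₁_lsc : LowerSemicontinuous Θ₁) (hΘ₂_lsc : LowerSemicontinuous Θ₂)
    (hθ : Tendsto θ atTop atTop)
    (hΘ₁ : Tendsto (fun x => Θ₁ x / x) atTop atTop)
    (hΘ₂ : Tendsto (fun x => Θ₂ x / x) atTop atTop)
    (hΘ₂_doubling : ∃ C : ℝ≥0, ∀ x, Θ₂ (2 * x) ≤ C * Θ₂ x) :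
    ∃ Ψ : C(I, ℝ) → ℝ≥0∞, IsCoerciveFunctional Ψ ∧
      ∀ (Ω : Type*) (mΩ : MeasurableSpace Ω) (P : Measure Ω) (_ : IsProbabilityMeasure P)
        (𝓕 : Filtration I mΩ) (φ β α : I → Ω → ℝ),
        IsStronglyProgressive 𝓕 φ → IsStronglyProgressive 𝓕 β → IsStronglyProgressive 𝓕 α →
        (∀ᵐ ω ∂P, Integrable fun t => β t ω) →
        (∀ᵐ ω ∂P, Integrable fun t => α t ω) →
        (∀ᵐ ω ∂P, ∀ᵐ t, 0 ≤ α t ω) →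
        IsContinuousLocalMartingale P 𝓕 (fun t ω => φ t ω - timeIntegral β t ω) →
        IsContinuousLocalMartingale P 𝓕
          (fun t ω => (φ t ω - timeIntegral β t ω) ^ 2 - timeIntegral α t ω) →
        ∫⁻ ω, pathValue Ψ (fun t => φ t ω) ∂P ≤
          ∫⁻ ω, ((θ ‖φ 0 ω‖₊ : ℝ≥0∞) +
            ∫⁻ t, ((Θ₁ ‖β t ω‖₊ : ℝ≥0∞) + (Θ₂ (α t ω).toNNReal : ℝ≥0∞))) ∂P := by
  have hm₁ := hΘ₁_lsc.measurable
  have hm₂ := hΘ₂_lsc.measurable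
  have hr : ∀ i : ℕ, ∃ r : ℝ≥0, ∀ x, r ≤ x → (i : ℝ≥0) ≤ θ x := fun i =>
    eventually_atTop.1 (hθ.eventually_ge_atTop (i : ℝ≥0))
  choose r hr using hr
  obtain ⟨δ, hδ0, hδ1⟩ := ENNReal.exists_pos_sum_of_countable one_ne_zero ℕ
  -- The grids are fixed before any process is introduced. The divisor `j + 1` offsets the weight
  -- `j` of the penalty, so the total is at most `∑ δ j` times the cost.
  have hn := fun j : ℕ => exists_measure_iUnion_exceedEvent_le hm₁ hm₂ hΘ₁ hΘ₂ hΘ₂_doubling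
    (ε := 1 / ((j : ℝ≥0) + 1)) (η := δ j / (j + 1)) (by positivity) (div_pos (hδ0 j) (by positivity))
  choose n hn0 hn using hn
  set ε : ℕ → ℝ := fun j => ((1 / ((j : ℝ≥0) + 1) : ℝ≥0) : ℝ) with hε
  refine ⟨oscFunctional (fun i => r i) n ε, isCoerciveFunctional_oscFunctional _ hn0 ?_, ?_⟩
  · simpa [hε] using tendsto_one_div_add_atTop_nhds_zero_nat (𝕜 := ℝ)
  intro Ω mΩ P _ 𝓕 φ β α hφ hβ hα hβi hαi hα0 hM hMA
  obtain ⟨Q, hQc, hQ⟩ := TopologicalSpace.exists_countable_dense I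
  have hφm : ∀ t, Measurable (φ t) := fun t =>
    ((hφ.stronglyAdapted t).mono (𝓕.le t)).measurable
  have hφc : ∀ᵐ ω ∂P, Continuous fun t => φ t ω := by
    filter_upwards [hM.continuous_paths, hβi] with ω h1 h2
    exact (h1.add (continuous_timeIntegral h2)).congr fun t => by simp
  set T : Ω → ℝ≥0∞ := fun ω =>
    ∫⁻ t, ((Θ₁ ‖β t ω‖₊ : ℝ≥0∞) + (Θ₂ (α t ω).toNNReal : ℝ≥0∞)) with hT
  have hTm : Measurable T :=
    Measurable.lintegral_prod_right' (f := fun p : Ω × I =>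
      (Θ₁ ‖β p.2 p.1‖₊ : ℝ≥0∞) + (Θ₂ (α p.2 p.1).toNNReal : ℝ≥0∞))
      ((hm₁.comp (hβ.measurable_uncurry.comp measurable_swap).nnnorm).coe_nnreal_ennreal.add
        (hm₂.comp (hα.measurable_uncurry.comp measurable_swap).real_toNNReal).coe_nnreal_ennreal)
  rw [lintegral_add_right _ hTm]
  refine (lintegral_pathValue_oscFunctional_le hφm hφc hQ hQc _ _ _).trans (add_le_add ?_ ?_)
  -- A supremum of penalties, rather than a sum, is dominated pointwise by `θ` with constant one.
  · refine lintegral_mono fun ω => iSup_le fun i => ?_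
    refine Set.indicator_apply_le' (fun h => ?_) fun _ => zero_le
    have h1 : r i ≤ ‖φ 0 ω‖₊ := by
      rw [← NNReal.coe_le_coe]
      exact le_of_lt h
    have h2 := ENNReal.coe_le_coe.2 (hr i _ h1)
    simpa using h2
  · calc ∑' j : ℕ, j * P (⋃ k ∈ Finset.range (n j),
          exceedEvent φ Q (gridPoint (n j) k) (gridPoint (n j) (k + 1)) (ε j))
        ≤ ∑' j : ℕ, (δ j : ℝ≥0∞) * ∫⁻ ω, T ω ∂P := by
          refine ENNReal.tsum_le_tsum fun j => ?_
          calc (j : ℝ≥0∞) * P (⋃ k ∈ Finset.range (n j),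
                exceedEvent φ Q (gridPoint (n j) k) (gridPoint (n j) (k + 1)) (ε j))
              ≤ (j : ℝ≥0∞) * ((δ j / (j + 1) : ℝ≥0) * ∫⁻ ω, T ω ∂P) := by
                gcongr
                exact hn j hφ hβ hα hβi hαi hα0 hM hMA hQ hQc
            _ = (j * (δ j / (j + 1)) : ℝ≥0) * ∫⁻ ω, T ω ∂P := by
                rw [← mul_assoc, ENNReal.coe_mul, ENNReal.coe_natCast]
            _ ≤ (δ j : ℝ≥0∞) * ∫⁻ ω, T ω ∂P := by
                gcongr
                calc (j : ℝ≥0) * (δ j / (j + 1)) ≤ (j + 1) * (δ j / (j + 1)) := by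
                      gcongr; exact le_self_add
                  _ = δ j := mul_div_cancel₀ _ (by positivity)
      _ = (∑' j : ℕ, (δ j : ℝ≥0∞)) * ∫⁻ ω, T ω ∂P := ENNReal.tsum_mul_right
      _ ≤ 1 * ∫⁻ ω, T ω ∂P := by gcongr
      _ = ∫⁻ ω, T ω ∂P := one_mul _
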